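/- **Conventions.** A *$\varphi$-function* is a continuous strictly increasing $F:[0,\infty)\to[0,\infty)$ with $F(0)=0$ and $F(t)\to\infty$ as $t\to\infty$; put $F(\infty)=\infty$, $\tilde F(t)=1/F(1/t)$ for $t>0$ and $\tilde F(0)=0$. $F$ is *dilatory* if for some $c_1,c_2>1$ we have $F(c_1t)\ge c_2F(t)$ for all $t\ge0$; $F$ satisfies the *$\Delta_2$-condition* if $F^{-1}$ is dilatory. $F$ and $G$ are *equivalent* ($F\asymp G$) if for some $c\in(0,\infty)$ we have $F(c^{-1}t)\le G(t)\le F(ct)$ for all $t\ge0$. Write $F\succ G$ if $F\circ G^{-1}$ is equivalent to a convex function. The measure space is $[0,\infty)$ with Lebesgue measure $\mu$. For measurable $f:[0,\infty)\to\mathbb C$ let $f^*(x)=\sup\{t\ge 0:\mu(|f|\ge t)\ge x\}\in[0,\infty]$. For measurable $g:[0,\infty)\to[0,\infty]$ let $\|g\|_G=\inf\{c>0:\int_0^\infty G(g(x)/c)\,dx\le1\}$ ($=\infty$ if there is no such $c$), and put $\|f\|_{F,G}=\|f^*\circ\tilde F\circ\tilde G^{-1}\|_G$. A $\varphi$-function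 $G$ is *almost convex* if there are real $a,b>1$ and $N\in\{1,2,\dots\}$ such that, for every $m\in\{1,2,\dots\}$, fewer than $b^m$ integers $n$ violate $G(a^{n+m})\ge a^{m-N}G(a^n)$. $G_1$ is *almost more convex* than $G_2$ if there are real $a,b>1$ and $N\in\{1,2,\dots\}$ such that, for every $m\in\{1,2,\dots\}$, fewer than $b^m$ integers $n$ violate $$\frac{G_2(a^{n+m})}{G_2(a^n)}\le a^N\,\frac{G_1(a^{n+m})}{G_1(a^n)} .$$ An *N-function* is a $\varphi$-function $H$ equivalent to a $\varphi$-function $H_0$ such that $H_0(t)/t$ is strictly increasing on $(0,\infty)$, tends to $\infty$ as $t\to\infty$ and tends to $0$ as $t\to0$. A $\varphi$-function $H^*$ is *complementary* to $H$ if for some $c\in(0,\infty)$ we have $c^{-1}t\le (H^*)^{-1}(t)\,H^{-1}(t)\le ct$ for all $t\ge0$. An N-function $H$ has a complementary function, unique up to equivalence, and $H$ satisfies *condition (J)* if $\bigl\|1/(\widetilde{H^*})^{-1}\bigr\|_{H^*}<\infty$ (independently of the choice of $H^*$). **Theorem 4.2.** Let $F$, $G_1$ and $G_2$ be $\varphi$-functions.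 Consider the following statements. (i) For some $c<\infty$, $\|f\|_{F,G_1}\le c\,\|f\|_{F,G_2}$ for all measurable $f:[0,\infty)\to\mathbb C$. (ii) $G_1\circ G_2^{-1}$ is almost convex. (iii) There is an N-function $H$ satisfying condition (J) such that $G_1\circ G_2^{-1}\succ H^{-1}$. (iv) $G_1$ is almost more convex than $G_2$. Then: if one of $G_1$, $G_2$ is dilatory, (ii)$\Rightarrow$(i). If one of $G_1$, $G_2$ is dilatory and $G_1$ satisfies the $\Delta_2$-condition, or if $G_2$ satisfies the $\Delta_2$-condition, (i)$\Rightarrow$(ii). If $G_2$ is dilatory and satisfies the $\Delta_2$-condition, (ii)$\Leftrightarrow$(iv). Always (ii)$\Leftrightarrow$(iii). -/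

import Mathlib

open Filter Topology MeasureTheory Set
open scoped NNReal ENNReal

/-- A `φ`-function: a strictly increasing continuous function `[0,∞) → [0,∞)` vanishing at `0` and
tending to infinity at infinity. -/
structure PhiFunction where
  toFun : ℝ≥0 → ℝ≥0
  map_zero' : toFun 0 = 0
  tendsto_atTop' : Tendsto toFun atTop atTop
  strictMono' : StrictMono toFun
  continuous' : Continuous toFun

namespace PhiFunction

instance : CoeFun PhiFunction (fun _ => ℝ≥0 → ℝ≥0) := ⟨toFun⟩

theorem surjective (F : PhiFunction) : Function.Surjective F := by
  intro y
  obtain ⟨x, hx⟩ := (F.tendsto_atTop'.eventually_ge_atTop y).exists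
  have h := intermediate_value_Icc (zero_le (a := x)) F.continuous'.continuousOn
  obtain ⟨z, -, hz⟩ := h ⟨by rw [F.map_zero']; exact zero_le, hx⟩
  exact ⟨z, hz⟩

/-- A strictly increasing surjection of `[0,∞)` onto itself is a `φ`-function. -/
def ofStrictMono (f : ℝ≥0 → ℝ≥0) (hm : StrictMono f) (hs : Function.Surjective f) :
    PhiFunction where
  toFun := f
  map_zero' := by
    obtain ⟨x, hx⟩ := hs 0
    have h : f 0 ≤ f x := hm.monotone zero_le
    exact le_antisymm (h.trans hx.le) zero_le
  tendsto_atTop' := (hm.orderIsoOfSurjective f hs).tendsto_atTop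
  strictMono' := hm
  continuous' := (hm.orderIsoOfSurjective f hs).continuous

/-- A `φ`-function as an order automorphism of `[0,∞)`. -/
noncomputable def toOrderIso (F : PhiFunction) : ℝ≥0 ≃o ℝ≥0 :=
  F.strictMono'.orderIsoOfSurjective F F.surjective

/-- The inverse function `F⁻¹`. -/
noncomputable def symm (F : PhiFunction) : PhiFunction :=
  ofStrictMono F.toOrderIso.symm F.toOrderIso.symm.strictMono F.toOrderIso.symm.surjective

theorem apply_symm (F : PhiFunction) (t : ℝ≥0) : F (F.symm t) = t :=
  F.toOrderIso.apply_symm_apply t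

theorem symm_apply (F : PhiFunction) (t : ℝ≥0) : F.symm (F t) = t :=
  F.toOrderIso.symm_apply_apply t

/-- The composition `F ∘ G`. -/
def comp (F G : PhiFunction) : PhiFunction where
  toFun := fun t => F (G t)
  map_zero' := by rw [G.map_zero', F.map_zero']
  tendsto_atTop' := F.tendsto_atTop'.comp G.tendsto_atTop'
  strictMono' := F.strictMono'.comp G.strictMono'
  continuous' := F.continuous'.comp G.continuous'

theorem pos (F : PhiFunction) {t : ℝ≥0} (ht : 0 < t) : 0 < F t := by
  have h := F.strictMono' ht
  rwa [F.map_zero'] at h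

/-- The function `F̃(t) = 1 / F(1/t)` for `t > 0`, `F̃(0) = 0`. -/
noncomputable def tilde (F : PhiFunction) : PhiFunction :=
  ofStrictMono (fun t => if t = 0 then 0 else 1 / F (1 / t))
    (by
      intro s t hst
      have ht : 0 < t := lt_of_le_of_lt zero_le hst
      rcases eq_or_ne s 0 with rfl | hs
      · simpa [ht.ne'] using F.pos (inv_pos.mpr ht)
      · have hs' : 0 < s := pos_iff_ne_zero.mpr hs
        simp only [hs, ht.ne', if_false]
        exact one_div_lt_one_div_of_lt (F.pos (one_div_pos.mpr ht))
          (F.strictMono' (one_div_lt_one_div_of_lt hs' hst)))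
    (by
      intro y
      rcases eq_or_ne y 0 with rfl | hy
      · exact ⟨0, by simp⟩
      · have hp : 0 < F.symm (1 / y) := F.symm.pos (one_div_pos.mpr (pos_iff_ne_zero.mpr hy))
        exact ⟨1 / F.symm (1 / y), by
          simp only [(one_div_pos.mpr hp).ne', if_false]
          simp [F.apply_symm]⟩)

/-- `F` is dilatory: for some `c₁, c₂ > 1`, `F(c₁ t) ≥ c₂ F(t)` for all `t ≥ 0`. -/
def Dilatory (F : PhiFunction) : Prop :=
  ∃ c₁ c₂ : ℝ≥0, 1 < c₁ ∧ 1 < c₂ ∧ ∀ t : ℝ≥0, c₂ * F t ≤ F (c₁ * t)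

/-- The `Δ₂`-condition: the inverse function is dilatory. -/
def Delta2 (F : PhiFunction) : Prop := F.symm.Dilatory

/-- Equivalence `F ≍ G`: for some `c < ∞`, `F(c⁻¹ t) ≤ G(t) ≤ F(c t)` for all `t ≥ 0`. -/
def Equivalent (F G : PhiFunction) : Prop :=
  ∃ c : ℝ≥0, 0 < c ∧ ∀ t : ℝ≥0, F (c⁻¹ * t) ≤ G t ∧ G t ≤ F (c * t)

/-- `F ≺ G`: the function `G ∘ F⁻¹` is equivalent to a convex function. (A convex function
`[0,∞) → [0,∞)` satisfying the inequalities of equivalence is automatically a `φ`-function.) -/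
def EquivalentlyLessConvex (F G : PhiFunction) : Prop :=
  ∃ C : PhiFunction, ConvexOn ℝ≥0 univ C ∧ (G.comp F.symm).Equivalent C

/-- `F ≻ G`, i.e. `G ≺ F`. -/
def EquivalentlyMoreConvex (F G : PhiFunction) : Prop := G.EquivalentlyLessConvex F

/-- `G` is almost convex: there are `a, b > 1` and `N ∈ {1, 2, …}` such that for all
`m ∈ {1, 2, …}` there are fewer than `b ^ m` integers `n` violating
`G(a^(n+m)) ≥ a^(m-N) G(a^n)`. -/
def AlmostConvex (G : PhiFunction) : Prop :=
  ∃ (a : ℝ≥0) (b : ℝ) (N : ℕ), 1 < a ∧ 1 < b ∧ 1 ≤ N ∧ ∀ m : ℕ, 1 ≤ m →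
    {n : ℤ | ¬ (a ^ ((m : ℤ) - (N : ℤ)) * G (a ^ n) ≤ G (a ^ (n + (m : ℤ))))}.Finite ∧
    ({n : ℤ | ¬ (a ^ ((m : ℤ) - (N : ℤ)) * G (a ^ n) ≤ G (a ^ (n + (m : ℤ))))}.ncard : ℝ) < b ^ m

/-- `G₁` is almost less convex than `G₂`: there are `a, b > 1` and `N ∈ {1, 2, …}` such that for
all `m ∈ {1, 2, …}` there are fewer than `b ^ m` integers `n` violating
`G₁(a^(n+m)) / G₁(a^n) ≤ a^N G₂(a^(n+m)) / G₂(a^n)`. -/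
def AlmostLessConvex (G₁ G₂ : PhiFunction) : Prop :=
  ∃ (a : ℝ≥0) (b : ℝ) (N : ℕ), 1 < a ∧ 1 < b ∧ 1 ≤ N ∧ ∀ m : ℕ, 1 ≤ m →
    {n : ℤ | ¬ (G₁ (a ^ (n + (m : ℤ))) / G₁ (a ^ n) ≤
      a ^ N * (G₂ (a ^ (n + (m : ℤ))) / G₂ (a ^ n)))}.Finite ∧
    ({n : ℤ | ¬ (G₁ (a ^ (n + (m : ℤ))) / G₁ (a ^ n) ≤
      a ^ N * (G₂ (a ^ (n + (m : ℤ))) / G₂ (a ^ n)))}.ncard : ℝ) < b ^ m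

/-- `G₁` is almost more convex than `G₂`, i.e. `G₂` is almost less convex than `G₁`. -/
def AlmostMoreConvex (G₁ G₂ : PhiFunction) : Prop := G₂.AlmostLessConvex G₁

/-- `N`-functions: `φ`-functions equivalent to some `F₀` for which `F₀(t)/t` is strictly
increasing, tends to infinity at infinity, and tends to `0` at `0`. -/
def IsNFunction (F : PhiFunction) : Prop :=
  ∃ F₀ : PhiFunction, F.Equivalent F₀ ∧
    StrictMonoOn (fun t : ℝ≥0 => F₀ t / t) (Ioi 0) ∧
    Tendsto (fun t : ℝ≥0 => F₀ t / t) atTop atTop ∧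
    Tendsto (fun t : ℝ≥0 => F₀ t / t) (𝓝[>] 0) (𝓝 0)

/-- `F` is complementary to `G`: for some `c < ∞`, `c⁻¹ t ≤ F⁻¹(t) G⁻¹(t) ≤ c t` for `t ≥ 0`. -/
def Complementary (F G : PhiFunction) : Prop :=
  ∃ c : ℝ≥0, 0 < c ∧ ∀ t : ℝ≥0,
    c⁻¹ * t ≤ F.symm t * G.symm t ∧ F.symm t * G.symm t ≤ c * t

/-- Extension of a `φ`-function to `[0,∞]` by `F(∞) = ∞`. -/
noncomputable def extend (F : PhiFunction) (x : ℝ≥0∞) : ℝ≥0∞ :=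
  if x = ∞ then ∞ else (F x.toNNReal : ℝ≥0∞)

end PhiFunction

/-- Lebesgue measure on `[0,∞)`. -/
noncomputable def lebesgueHalfLine : Measure ℝ≥0 :=
  Measure.comap ((↑) : ℝ≥0 → ℝ) volume

/-- The Luxemburg functional `‖g‖_G = inf {c : ∫ G(g / c) dμ ≤ 1}` of a `[0,∞]`-valued function;
it is `∞` if there is no such `c`. -/
noncomputable def luxemburg {Ω : Type*} [MeasurableSpace Ω] (μ : Measure Ω) (G : PhiFunction)
    (g : Ω → ℝ≥0∞) : ℝ≥0∞ :=
  ⨅ (c : ℝ≥0) (_ : 0 < c) (_ : ∫⁻ ω, G.extend (g ω / (c : ℝ≥0∞)) ∂μ ≤ 1), (c : ℝ≥0∞)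

/-- The non-increasing rearrangement `f*(x) = sup {t : μ(|f| ≥ t) ≥ x}`. -/
noncomputable def rearrangement {Ω : Type*} [MeasurableSpace Ω] (μ : Measure Ω) (f : Ω → ℂ)
    (x : ℝ≥0) : ℝ≥0∞ :=
  ⨆ (t : ℝ≥0) (_ : (x : ℝ≥0∞) ≤ μ {ω | t ≤ ‖f ω‖₊}), (t : ℝ≥0∞)

/-- The Orlicz–Lorentz functional `‖f‖_{F,G} = ‖f* ∘ F̃ ∘ G̃⁻¹‖_G`, where the outer functional is
taken over `[0,∞)` with Lebesgue measure. -/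
noncomputable def orliczLorentz {Ω : Type*} [MeasurableSpace Ω] (μ : Measure Ω)
    (F G : PhiFunction) (f : Ω → ℂ) : ℝ≥0∞ :=
  luxemburg lebesgueHalfLine G
    (fun x => rearrangement μ f (F.tilde (G.tilde.symm x)))

/-- Condition (J) for an `N`-function `H`: `‖1 / H̃*⁻¹‖_{H*} < ∞` over `[0,∞)` with Lebesgue
measure, where `H*` is complementary to `H`. An `N`-function has a complementary function and any
two of them are equivalent, so that the choice of `H*` is immaterial. -/
def PhiFunction.ConditionJ (H : PhiFunction) : Prop :=
  ∃ K : PhiFunction, K.Complementary H ∧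
    luxemburg lebesgueHalfLine K (fun x => 1 / (K.tilde.symm x : ℝ≥0∞)) < ∞

/-!
Write `T = G₁ ∘ G₂⁻¹`. After the substitution `h = G₂ ∘ f* ∘ F̃ ∘ G̃₂⁻¹` the function `F` disappears,
and the comparison of the two functionals becomes the question whether `∫ h ≤ 1` bounds
`∫ T(h) dT̃` for decreasing `h`, where `T̃(x) = 1 / T(1/x)`. Along a geometric grid this asks for
`∑ T(zₙ) / T(aⁿ)` to be bounded when `∑ zₙ / aⁿ` is.

The pivot is `PhiFunction.SummablyControlled`: the inequality `T(z) / T(aⁿ) ≤ C (z / aⁿ + eₙ)` for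
`z ≤ aⁿ`, with a summable error `e`. If `T ∘ H` is equivalent to a convex function, the ratio on the
left is at most a multiple of `H⁻¹(z) / H⁻¹(aⁿ)`. With `K` complementary to `H`, so that
`H⁻¹(y)` is comparable to `y / K⁻¹(y)`, a case distinction at `z = K(ε K⁻¹(aⁿ))` gives the control
with `eₙ = K(ε K⁻¹(aⁿ)) / aⁿ`, and condition (J) says exactly that these errors are summable
(`PhiFunction.ConditionJ.summablyControlled`). The control implies almost convexity by counting large
errors, and it implies the comparison of norms by summation over the grid. The latter needs, for
the cells in which `h` exceeds `aⁿ`, a bound independent of the growth of `T`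
(`PhiFunction.setLIntegral_tilde_symm_le_three`), and it needs `G₁` to be dilatory; as an almost
convex `T` is dilatory, it suffices that `G₂` is.

Conversely, for an almost convex `T` the `N`-function is constructed
(`PhiFunction.AlmostConvex.exists_nFunction`). The grid is divided greedily into cells free of
intervals violating almost convexity. Since each cell contains a violating interval and there are
few of those of each length, the cells are long, in the sense that the ratios of their ends `Y j`
have a summable power. The concave function `φ(y) = ∑ⱼ A ^ (-j) min(y, Y j)` is such that
`y / φ(y)` is of size `A ^ j` at `Y j`. Hence `H = φ⁻¹` is an `N`-function, the inverse of
`y / φ(y)` is complementary to it, condition (J) is the summability of ratios of nodes, and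
`T(y) / φ(y)` is increasing up to a constant, so that `T ∘ H` is equivalent to a convex function.

That the comparison of norms implies almost convexity is seen by testing it on step functions. First,
infinitely many separated long intervals on which `T` is nearly constant would violate the
comparison, so `T` is dilatory; then the levels `aⁿ` are separated, and a step function built from
too many violating pairs violates the comparison
(`PhiFunction.SparselyControlled.almostConvex`).

If `G₂` is dilatory and satisfies the `Δ₂`-condition, almost convexity of `T` and almost greater
convexity of `G₁` are the same condition along the comparable grids `G₂⁻¹(aⁿ)` and `aⁿ`.
-/

/-! ### Basic facts on `φ`-functions and on integration over the half line -/

namespace PhiFunction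

theorem eq_of_forall_apply_eq {F G : PhiFunction} (h : ∀ t, F t = G t) : F = G := by
  cases F; cases G
  simp only [PhiFunction.mk.injEq]
  exact funext h

theorem map_zero (F : PhiFunction) : F 0 = 0 := F.map_zero'

theorem strictMono (F : PhiFunction) : StrictMono F := F.strictMono'

theorem monotone (F : PhiFunction) : Monotone F := F.strictMono'.monotone

theorem comp_apply (F G : PhiFunction) (t : ℝ≥0) : F.comp G t = F (G t) := rfl

theorem le_iff (F : PhiFunction) {s t : ℝ≥0} : F s ≤ F t ↔ s ≤ t := F.strictMono.le_iff_le

theorem lt_iff (F : PhiFunction) {s t : ℝ≥0} : F s < F t ↔ s < t := F.strictMono.lt_iff_lt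

theorem symm_eq_of_apply_eq (F : PhiFunction) {s t : ℝ≥0} (h : F s = t) : F.symm t = s := by
  rw [← h, F.symm_apply]

theorem symm_symm (F : PhiFunction) : F.symm.symm = F :=
  eq_of_forall_apply_eq fun t => F.symm.symm_eq_of_apply_eq (F.symm_apply t)

theorem symm_le_iff (F : PhiFunction) {s t : ℝ≥0} : F.symm s ≤ t ↔ s ≤ F t := by
  rw [← F.le_iff, F.apply_symm]

theorem le_symm_iff (F : PhiFunction) {s t : ℝ≥0} : s ≤ F.symm t ↔ F s ≤ t := by
  rw [← F.le_iff, F.apply_symm]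

/-- With the conventions `0⁻¹ = 0` and `F̃ 0 = 0` the formula for `F̃` holds at `0` as well. -/
theorem tilde_apply (F : PhiFunction) (t : ℝ≥0) : F.tilde t = (F t⁻¹)⁻¹ := by
  change (if t = 0 then 0 else 1 / F (1 / t)) = _
  split_ifs with h
  · simp [h, F.map_zero]
  · simp

theorem tilde_symm_apply (F : PhiFunction) (x : ℝ≥0) : F.tilde.symm x = (F.symm x⁻¹)⁻¹ :=
  F.tilde.symm_eq_of_apply_eq (by simp [tilde_apply, F.apply_symm])

theorem comp_symm_tilde_symm (G₁ G₂ : PhiFunction) (x : ℝ≥0) :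
    (G₁.comp G₂.symm).tilde.symm x = G₂.tilde (G₁.tilde.symm x) := by
  apply symm_eq_of_apply_eq
  simp [tilde_apply, tilde_symm_apply, comp_apply, symm_apply, apply_symm]

@[simp] theorem extend_coe (F : PhiFunction) (t : ℝ≥0) : F.extend (t : ℝ≥0∞) = F t := by
  simp [extend]

@[simp] theorem extend_top (F : PhiFunction) : F.extend ∞ = ∞ := by simp [extend]

theorem extend_mono (F : PhiFunction) : Monotone F.extend := by
  intro s t h
  induction t using ENNReal.recTopCoe with
  | top => simp
  | coe t =>
    lift s to ℝ≥0 using ne_top_of_le_ne_top ENNReal.coe_ne_top h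
    simpa using F.monotone (by exact_mod_cast h)

theorem extend_comp_symm (G₁ G₂ : PhiFunction) (u : ℝ≥0∞) :
    (G₁.comp G₂.symm).extend (G₂.extend u) = G₁.extend u := by
  induction u using ENNReal.recTopCoe with
  | top => simp
  | coe t => simp [comp_apply, symm_apply]

/-- A dilatory function can be made to grow by any prescribed factor. -/
theorem Dilatory.exists_mul_le {F : PhiFunction} (hF : F.Dilatory) (M : ℝ≥0) :
    ∃ c : ℝ≥0, 1 ≤ c ∧ ∀ t, M * F t ≤ F (c * t) := by
  obtain ⟨c₁, c₂, h₁, h₂, h⟩ := hF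
  obtain ⟨k, hk⟩ := pow_unbounded_of_one_lt M h₂
  refine ⟨c₁ ^ k, one_le_pow₀ h₁.le, fun t => ?_⟩
  have key : ∀ j : ℕ, c₂ ^ j * F t ≤ F (c₁ ^ j * t) := by
    intro j
    induction j with
    | zero => simp
    | succ j ih =>
      calc c₂ ^ (j + 1) * F t = c₂ * (c₂ ^ j * F t) := by ring
        _ ≤ c₂ * F (c₁ ^ j * t) := by gcongr
        _ ≤ F (c₁ * (c₁ ^ j * t)) := h _
        _ = F (c₁ ^ (j + 1) * t) := by ring_nf
  exact (mul_le_mul_left hk.le _).trans (key k)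

end PhiFunction

theorem lebesgueHalfLine_Ioc (p q : ℝ≥0) :
    lebesgueHalfLine (Ioc p q) = ((q - p : ℝ≥0) : ℝ≥0∞) := by
  have he : MeasurableEmbedding ((↑) : ℝ≥0 → ℝ) :=
    MeasurableEmbedding.subtype_coe measurableSet_Ici
  have himg : ((↑) : ℝ≥0 → ℝ) '' Ioc p q = Ioc (p : ℝ) q := by
    ext x
    constructor
    · rintro ⟨y, hy, rfl⟩
      exact ⟨by exact_mod_cast hy.1, by exact_mod_cast hy.2⟩
    · intro hx
      exact ⟨⟨x, p.2.trans hx.1.le⟩, ⟨by exact_mod_cast hx.1, by exact_mod_cast hx.2⟩, rfl⟩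
  rw [lebesgueHalfLine, he.comap_apply, himg, Real.volume_Ioc, ENNReal.ofReal, NNReal.sub_def]

theorem lebesgueHalfLine_singleton_zero : lebesgueHalfLine {0} = 0 := by
  have he : MeasurableEmbedding ((↑) : ℝ≥0 → ℝ) :=
    MeasurableEmbedding.subtype_coe measurableSet_Ici
  rw [lebesgueHalfLine, he.comap_apply]
  simp

theorem lebesgueHalfLine_Iic (q : ℝ≥0) : lebesgueHalfLine (Iic q) = (q : ℝ≥0∞) := by
  have h : Iic q = {0} ∪ Ioc 0 q := by
    ext x
    rcases eq_or_ne x 0 with rfl | hx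
    · simp
    · simp
  apply le_antisymm
  · rw [h]
    refine (measure_union_le _ _).trans ?_
    simp [lebesgueHalfLine_singleton_zero, lebesgueHalfLine_Ioc]
  · calc (q : ℝ≥0∞) = lebesgueHalfLine (Ioc 0 q) := by simp [lebesgueHalfLine_Ioc]
      _ ≤ _ := measure_mono Ioc_subset_Iic_self

/-- A bound of an integral over the half line by the sum over consecutive cells accumulating at
`0`. -/
theorem lintegral_le_tsum_Ioc (g : ℝ≥0 → ℝ≥0∞) (x : ℤ → ℝ≥0)
    (hx : ∀ t, 0 < t → ∃ n, t ∈ Ioc (x (n + 1)) (x n)) :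
    ∫⁻ t, g t ∂lebesgueHalfLine ≤ ∑' n, ∫⁻ t in Ioc (x (n + 1)) (x n), g t ∂lebesgueHalfLine := by
  refine le_trans ?_ (lintegral_iUnion_le _ _)
  have hae : ∀ᵐ t ∂lebesgueHalfLine, t ∈ ⋃ n, Ioc (x (n + 1)) (x n) := by
    refine measure_mono_null (t := {0}) ?_ lebesgueHalfLine_singleton_zero
    intro t ht
    by_contra h0
    exact ht (mem_iUnion.2 (hx t (pos_iff_ne_zero.2 h0)))
  rw [Measure.restrict_eq_self_of_ae_mem hae]

theorem setLIntegral_Ioc_le (g : ℝ≥0 → ℝ≥0∞) (p q : ℝ≥0) (c : ℝ≥0∞)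
    (h : ∀ t ∈ Ioc p q, g t ≤ c) :
    ∫⁻ t in Ioc p q, g t ∂lebesgueHalfLine ≤ c * ((q - p : ℝ≥0) : ℝ≥0∞) := by
  refine (setLIntegral_mono' measurableSet_Ioc h).trans ?_
  simp [lebesgueHalfLine_Ioc]

theorem le_setLIntegral_Ioc (g : ℝ≥0 → ℝ≥0∞) (p q : ℝ≥0) (c : ℝ≥0∞)
    (h : ∀ t ∈ Ioc p q, c ≤ g t) :
    c * ((q - p : ℝ≥0) : ℝ≥0∞) ≤ ∫⁻ t in Ioc p q, g t ∂lebesgueHalfLine := by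
  refine le_trans ?_ (setLIntegral_mono' measurableSet_Ioc h)
  simp [lebesgueHalfLine_Ioc]

/-- The lower Riemann sum of a decreasing function along the geometric grid `a ^ (-n)`. -/
theorem tsum_zpow_le_lintegral (g : ℝ≥0 → ℝ≥0∞) (hg : ∀ s t, 0 < s → s ≤ t → g t ≤ g s)
    {a : ℝ≥0} (ha : 1 < a) :
    ∑' n : ℤ, g (a ^ (-n)) * ((a ^ (-n) * (1 - a⁻¹) : ℝ≥0) : ℝ≥0∞) ≤
      ∫⁻ t, g t ∂lebesgueHalfLine := by
  have ha0 : 0 < a := one_pos.trans ha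
  have hmono : Antitone fun n : ℤ => a ^ (-n) := fun i j hij =>
    zpow_le_zpow_right₀ ha.le (neg_le_neg hij)
  have hdisj : Pairwise (Function.onFun Disjoint fun n : ℤ => Ioc (a ^ (-(n + 1))) (a ^ (-n))) :=
    hmono.pairwise_disjoint_on_Ioc_succ
  calc _ ≤ ∑' n : ℤ, ∫⁻ t in Ioc (a ^ (-(n + 1))) (a ^ (-n)), g t ∂lebesgueHalfLine := by
        refine ENNReal.tsum_le_tsum fun n => ?_
        have : a ^ (-n) * (1 - a⁻¹) = a ^ (-n) - a ^ (-(n + 1)) := by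
          rw [mul_tsub, mul_one, neg_add, zpow_add₀ ha0.ne', zpow_neg_one]
        rw [this]
        refine le_setLIntegral_Ioc _ _ _ _ fun t ht => hg _ _ ?_ ht.2
        exact lt_of_le_of_lt zero_le ht.1
    _ = ∫⁻ t in ⋃ n : ℤ, Ioc (a ^ (-(n + 1))) (a ^ (-n)), g t ∂lebesgueHalfLine :=
        (lintegral_iUnion (fun _ => measurableSet_Ioc) hdisj _).symm
    _ ≤ _ := setLIntegral_le_lintegral _ _

theorem exists_mem_Ioc_zpow_neg {a : ℝ≥0} (ha : 1 < a) {t : ℝ≥0} (ht : 0 < t) :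
    ∃ n : ℤ, t ∈ Ioc (a ^ (-(n + 1))) (a ^ (-n)) := by
  obtain ⟨n, hn⟩ := exists_mem_Ioc_zpow ht ha
  exact ⟨-(n + 1), by simpa using hn⟩

theorem rearrangement_antitone {Ω : Type*} [MeasurableSpace Ω] (μ : Measure Ω) (f : Ω → ℂ) :
    Antitone (rearrangement μ f) := by
  intro x y hxy
  refine iSup_mono fun t => iSup_mono' fun h => ⟨le_trans (by exact_mod_cast hxy) h, le_rfl⟩

/-! ### Summable control of ratios -/

namespace PhiFunction

/-- The ratio `T(z) / T(aⁿ)` with `z ≤ aⁿ` is at most a multiple of the ratio `z / aⁿ` of the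
arguments, up to an error `e n` which depends on `n` only and is summable over `n`. -/
def SummablyControlled (T : PhiFunction) : Prop :=
  ∀ a : ℝ≥0, 1 < a → ∃ (C : ℝ≥0) (e : ℤ → ℝ≥0), Summable e ∧
    ∀ (n : ℤ) (z : ℝ≥0), z ≤ a ^ n → T z ≤ C * (z / a ^ n + e n) * T (a ^ n)

theorem convex_apply_mul_le {M : PhiFunction} (hM : ConvexOn ℝ≥0 univ M) {l : ℝ≥0} (hl : l ≤ 1)
    (t : ℝ≥0) : M (l * t) ≤ l * M t := by
  have h0 := hM.2
  have h := h0 (mem_univ t) (mem_univ 0) (a := l) (b := 1 - l) zero_le zero_le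
    (add_tsub_cancel_of_le hl)
  simpa [M.map_zero] using h

/-- A convex function vanishing at `0` satisfies `M(l t) ≤ l M(t)` for `l ≤ 1`; read off for
`T ∘ H` this bounds the ratios of `T` by those of `H⁻¹`. -/
theorem exists_le_symm_ratio {T H : PhiFunction} (hT : T.EquivalentlyMoreConvex H.symm) :
    ∃ C : ℝ≥0, ∀ z y : ℝ≥0, z ≤ y → 0 < y → T z ≤ C * (H.symm z / H.symm y) * T y := by
  obtain ⟨M, hM, c, hc, h⟩ := hT
  rw [symm_symm] at h
  refine ⟨c ^ 2, fun z y hzy hy => ?_⟩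
  have ht : 0 < H.symm y := H.symm.pos hy
  have hz : T z ≤ M (c * H.symm z) := by
    have := (h (c * H.symm z)).1
    rwa [inv_mul_cancel_left₀ hc.ne', comp_apply, apply_symm] at this
  have hy' : M (c⁻¹ * H.symm y) ≤ T y := by
    have := (h (c⁻¹ * H.symm y)).2
    rwa [mul_inv_cancel_left₀ hc.ne', comp_apply, apply_symm] at this
  rcases le_total (c ^ 2 * (H.symm z / H.symm y)) 1 with hl | hl
  · calc T z ≤ M (c * H.symm z) := hz
      _ = M ((c ^ 2 * (H.symm z / H.symm y)) * (c⁻¹ * H.symm y)) := by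
        congr 1; field_simp
      _ ≤ (c ^ 2 * (H.symm z / H.symm y)) * M (c⁻¹ * H.symm y) := convex_apply_mul_le hM hl _
      _ ≤ _ := by gcongr
  · calc T z ≤ T y := T.monotone hzy
      _ ≤ _ := le_mul_of_one_le_left zero_le hl

theorem exists_lintegral_le_of_luxemburg_lt_top {Ω : Type*} [MeasurableSpace Ω] {μ : Measure Ω}
    {G : PhiFunction} {g : Ω → ℝ≥0∞} (h : luxemburg μ G g < ∞) :
    ∃ c : ℝ≥0, 0 < c ∧ ∫⁻ ω, G.extend (g ω / (c : ℝ≥0∞)) ∂μ ≤ 1 := by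
  by_contra! hc
  refine h.ne ?_
  simp only [luxemburg, iInf_eq_top]
  intro c h0 h1
  exact absurd h1 (not_le.2 (hc c h0))

/-- For `K` complementary to `H` and `w = K⁻¹(aⁿ)` the error `e n` is `K(w / d) / aⁿ`. The sum of
these errors is a lower Riemann sum of the integral in condition (J). -/
theorem ConditionJ.exists_summable {H : PhiFunction} (hJ : H.ConditionJ) {a : ℝ≥0} (ha : 1 < a) :
    ∃ (C : ℝ≥0) (e : ℤ → ℝ≥0), Summable e ∧
      ∀ (n : ℤ) (z : ℝ≥0), z ≤ a ^ n → H.symm z / H.symm (a ^ n) ≤ C * (z / a ^ n + e n) := by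
  obtain ⟨K, ⟨c, hc, hK⟩, hJ⟩ := hJ
  obtain ⟨d, hd, hint⟩ := exists_lintegral_le_of_luxemburg_lt_top hJ
  have ha0 : 0 < a := one_pos.trans ha
  have hδ : 0 < 1 - a⁻¹ := tsub_pos_of_lt (inv_lt_one_of_one_lt₀ ha)
  let g : ℝ≥0 → ℝ≥0∞ := fun x => K.extend (1 / (K.tilde.symm x : ℝ≥0∞) / d)
  have hgval : ∀ n : ℤ, g (a ^ (-n)) = (K (d⁻¹ * K.symm (a ^ n)) : ℝ≥0) := by
    intro n
    have h1 : K.tilde.symm (a ^ (-n)) = (K.symm (a ^ n))⁻¹ := by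
      rw [tilde_symm_apply, zpow_neg, inv_inv]
    have h2 : 0 < K.symm (a ^ n) := K.symm.pos (zpow_pos ha0 n)
    simp only [g, h1]
    rw [one_div, ← ENNReal.coe_inv (inv_pos.2 h2).ne', inv_inv, ← ENNReal.coe_div hd.ne',
      extend_coe, div_eq_inv_mul]
  have hg : ∀ s t, 0 < s → s ≤ t → g t ≤ g s := by
    intro s t _ hst
    refine K.extend_mono (ENNReal.div_le_div_right (ENNReal.div_le_div_left ?_ _) _)
    exact_mod_cast K.tilde.symm.monotone hst
  have hsum := (tsum_zpow_le_lintegral g hg ha).trans hint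
  refine ⟨c ^ 2 * d, fun n => K (d⁻¹ * K.symm (a ^ n)) / a ^ n, ?_, ?_⟩
  · have hs : Summable fun n : ℤ => K (d⁻¹ * K.symm (a ^ n)) * (a ^ (-n) * (1 - a⁻¹)) := by
      rw [← ENNReal.tsum_coe_ne_top_iff_summable]
      refine ne_top_of_le_ne_top ENNReal.one_ne_top (le_trans (le_of_eq ?_) hsum)
      exact tsum_congr fun n => by rw [hgval, ENNReal.coe_mul]
    refine (hs.mul_right (1 - a⁻¹)⁻¹).congr fun n => ?_
    rw [zpow_neg, ← mul_assoc, mul_inv_cancel_right₀ hδ.ne', div_eq_mul_inv]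
  · intro n z hz
    set y := a ^ n
    have hy0 : 0 < y := zpow_pos ha0 n
    have hw : 0 < K.symm y := K.symm.pos hy0
    -- Up to the threshold `K(d⁻¹ K⁻¹(y))` only monotonicity of `H⁻¹` is used; beyond it,
    -- `H⁻¹(z)` is compared with `z / K⁻¹(z)`.
    have key : ∀ u, K (d⁻¹ * K.symm y) ≤ u →
        H.symm u / H.symm y ≤ c ^ 2 * d * (u / y) := by
      intro u hu
      have hu0 : d⁻¹ * K.symm y ≤ K.symm u := K.le_symm_iff.2 hu
      have hh : 0 < H.symm y := H.symm.pos hy0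
      have h1 := (hK u).2
      have h2 := (hK y).1
      rw [div_le_iff₀ hh]
      have h3 : d⁻¹ * K.symm y * H.symm u ≤ c * u := le_trans (by gcongr) h1
      have h4 : K.symm y * H.symm u ≤ d * (c * u) := by
        calc K.symm y * H.symm u = d * (d⁻¹ * K.symm y * H.symm u) := by field_simp
          _ ≤ _ := by gcongr
      have h5 : y ≤ c * (K.symm y * H.symm y) := by
        calc y = c * (c⁻¹ * y) := by field_simp
          _ ≤ _ := by gcongr
      refine le_of_mul_le_mul_left ?_ hw
      calc K.symm y * H.symm u ≤ d * (c * u) := h4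
        _ = d * c * u / y * y := by field_simp
        _ ≤ d * c * u / y * (c * (K.symm y * H.symm y)) := by gcongr
        _ = _ := by ring
    rcases le_total (K (d⁻¹ * K.symm y)) z with h | h
    · exact (key z h).trans (by gcongr; exact le_self_add)
    · have h1 : H.symm z / H.symm y ≤ H.symm (K (d⁻¹ * K.symm y)) / H.symm y := by
        gcongr; exact H.symm.monotone h
      exact h1.trans ((key _ le_rfl).trans (by gcongr; exact le_add_self))

theorem ConditionJ.summablyControlled {T H : PhiFunction} (hJ : H.ConditionJ)
    (hT : T.EquivalentlyMoreConvex H.symm) : T.SummablyControlled := by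
  intro a ha
  obtain ⟨C, hC⟩ := exists_le_symm_ratio hT
  obtain ⟨C', e, he, h⟩ := hJ.exists_summable ha
  refine ⟨C * C', e, he, fun n z hz => ?_⟩
  have ha0 : 0 < a := one_pos.trans ha
  calc T z ≤ C * (H.symm z / H.symm (a ^ n)) * T (a ^ n) := hC _ _ hz (zpow_pos ha0 n)
    _ ≤ C * (C' * (z / a ^ n + e n)) * T (a ^ n) := by gcongr; exact h n z hz
    _ = _ := by ring

/-- The number of terms of a summable family above a threshold. -/
theorem finite_ncard_le_of_summable {ι : Type*} {e : ι → ℝ≥0} (he : Summable e) {r : ℝ≥0}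
    (hr : 0 < r) : {i | r ≤ e i}.Finite ∧ ({i | r ≤ e i}.ncard : ℝ≥0) * r ≤ ∑' i, e i := by
  have hf : {i | r ≤ e i}.Finite := by
    have h := (NNReal.tendsto_cofinite_zero_of_summable he).eventually_lt_const hr
    refine h.subset ?_
    intro i hi
    simpa using hi
  refine ⟨hf, ?_⟩
  calc ({i | r ≤ e i}.ncard : ℝ≥0) * r = ∑ _i ∈ hf.toFinset, r := by
        rw [Finset.sum_const, nsmul_eq_mul, Set.ncard_eq_toFinset_card _ hf]
    _ ≤ ∑ i ∈ hf.toFinset, e i := Finset.sum_le_sum fun i hi => by simpa using hi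
    _ ≤ _ := he.sum_le_tsum _ (fun _ _ => zero_le)

/-- A pair `(n, n + m)` violating almost convexity forces `e (n + m) ≥ a ^ (-m)`, and at most a
multiple of `a ^ m` terms of a summable family are that large. -/
theorem SummablyControlled.almostConvex {T : PhiFunction} (hT : T.SummablyControlled) :
    T.AlmostConvex := by
  obtain ⟨C, e, he, h⟩ := hT 2 one_lt_two
  obtain ⟨k, hk⟩ := pow_unbounded_of_one_lt (2 * C) (one_lt_two (α := ℝ≥0))
  set S := ∑' i, e i
  refine ⟨2, 2 * (S + 1 : ℝ≥0), k + 1, one_lt_two, ?_, by omega, fun m hm => ?_⟩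
  · have : (0 : ℝ) ≤ S := S.2
    push_cast
    linarith
  have h2m : (0 : ℝ≥0) < 2⁻¹ ^ m := by positivity
  obtain ⟨hfin, hcard⟩ := finite_ncard_le_of_summable he h2m
  have hsub : {n : ℤ | ¬ ((2 : ℝ≥0) ^ ((m : ℤ) - ((k + 1 : ℕ) : ℤ)) * T (2 ^ n) ≤
      T (2 ^ (n + (m : ℤ))))} ⊆ (fun n : ℤ => n - m) '' {i | 2⁻¹ ^ m ≤ e i} := by
    intro n hn
    refine ⟨n + m, ?_, by simp⟩
    by_contra hlt
    simp only [mem_ofPred_eq, not_le] at hlt hn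
    have h1 := h (n + m) (2 ^ n) (zpow_le_zpow_right₀ one_le_two (by omega))
    have h2 : (2 : ℝ≥0) ^ n / 2 ^ (n + (m : ℤ)) = 2⁻¹ ^ m := by
      rw [zpow_add₀ two_ne_zero, inv_pow, zpow_natCast]
      field_simp
    rw [h2] at h1
    have h3 : T (2 ^ n) ≤ 2 ^ k * 2⁻¹ ^ m * T (2 ^ (n + (m : ℤ))) := by
      calc T (2 ^ n) ≤ C * (2⁻¹ ^ m + 2⁻¹ ^ m) * T (2 ^ (n + (m : ℤ))) := h1.trans (by gcongr)
        _ = (2 * C) * 2⁻¹ ^ m * T (2 ^ (n + (m : ℤ))) := by ring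
        _ ≤ _ := by gcongr
    have h4 : (2 : ℝ≥0) ^ ((m : ℤ) - ((k + 1 : ℕ) : ℤ)) = 2 ^ m / (2 * 2 ^ k) := by
      rw [zpow_sub₀ two_ne_zero]
      simp only [zpow_natCast, pow_succ']
    rw [h4] at hn
    have h5 : (2 : ℝ≥0) ^ m / (2 * 2 ^ k) * T (2 ^ n) ≤ 2⁻¹ * T (2 ^ (n + (m : ℤ))) := by
      calc (2 : ℝ≥0) ^ m / (2 * 2 ^ k) * T (2 ^ n)
          ≤ (2 : ℝ≥0) ^ m / (2 * 2 ^ k) * (2 ^ k * 2⁻¹ ^ m * T (2 ^ (n + (m : ℤ)))) := by gcongr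
        _ = _ := by rw [inv_pow]; field_simp
    have h6 : 2⁻¹ * T (2 ^ (n + (m : ℤ))) ≤ T (2 ^ (n + (m : ℤ))) :=
      mul_le_of_le_one_left zero_le (by norm_num)
    exact absurd hn (not_lt.2 (h5.trans h6))
  have hfin' := hfin.image (fun n : ℤ => n - m)
  refine ⟨hfin'.subset hsub, ?_⟩
  have hle := (Set.ncard_le_ncard hsub hfin').trans (Set.ncard_image_le hfin)
  have h7 : ({i | 2⁻¹ ^ m ≤ e i}.ncard : ℝ≥0) ≤ S * 2 ^ m := by
    calc _ = ({i | 2⁻¹ ^ m ≤ e i}.ncard : ℝ≥0) * 2⁻¹ ^ m * 2 ^ m := by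
          rw [inv_pow]; field_simp
      _ ≤ _ := by gcongr
  have h8 : S * 2 ^ m < (2 * (S + 1)) ^ m := by
    rw [mul_pow, mul_comm]
    have : S < (S + 1) ^ m :=
      lt_of_lt_of_le (lt_add_one S) (le_self_pow₀ le_add_self (by omega))
    gcongr
  calc _ ≤ (({i | 2⁻¹ ^ m ≤ e i}.ncard : ℕ) : ℝ) := by exact_mod_cast hle
    _ ≤ ((S * 2 ^ m : ℝ≥0) : ℝ) := by exact_mod_cast h7
    _ < (((2 * (S + 1)) ^ m : ℝ≥0) : ℝ) := by exact_mod_cast h8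
    _ = _ := by push_cast; ring

end PhiFunction

/-! ### Sufficiency: comparison of the norms -/

theorem mul_add_mul_add_mul_le_lintegral {h : ℝ≥0 → ℝ≥0∞} (hh : Antitone h) {p q r : ℝ≥0}
    (hpq : p ≤ q) (hqr : q ≤ r) :
    h p * (p : ℝ≥0∞) + h q * ((q - p : ℝ≥0) : ℝ≥0∞) + h r * ((r - q : ℝ≥0) : ℝ≥0∞) ≤
      ∫⁻ x, h x ∂lebesgueHalfLine := by
  have h1 := le_setLIntegral_Ioc h 0 p (h p) fun t ht => hh ht.2
  have h2 := le_setLIntegral_Ioc h p q (h q) fun t ht => hh ht.2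
  have h3 := le_setLIntegral_Ioc h q r (h r) fun t ht => hh ht.2
  rw [tsub_zero] at h1
  have e1 : ∫⁻ t in Ioc 0 q, h t ∂lebesgueHalfLine =
      (∫⁻ t in Ioc 0 p, h t ∂lebesgueHalfLine) + ∫⁻ t in Ioc p q, h t ∂lebesgueHalfLine := by
    rw [← Ioc_union_Ioc_eq_Ioc (zero_le (a := p)) hpq,
      lintegral_union measurableSet_Ioc (Ioc_disjoint_Ioc_of_le le_rfl)]
  have e2 : ∫⁻ t in Ioc 0 r, h t ∂lebesgueHalfLine =
      (∫⁻ t in Ioc 0 q, h t ∂lebesgueHalfLine) + ∫⁻ t in Ioc q r, h t ∂lebesgueHalfLine := by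
    rw [← Ioc_union_Ioc_eq_Ioc (zero_le (a := q)) hqr,
      lintegral_union measurableSet_Ioc (Ioc_disjoint_Ioc_of_le le_rfl)]
  calc _ ≤ ∫⁻ t in Ioc 0 r, h t ∂lebesgueHalfLine := by rw [e2, e1]; gcongr
    _ ≤ _ := setLIntegral_le_lintegral _ _

/-- A decreasing function of integral at most `1` on the half line is finite off `0`. -/
theorem exists_eq_coe_of_antitone {h : ℝ≥0 → ℝ≥0∞} (hh : Antitone h)
    (hint : ∫⁻ x, h x ∂lebesgueHalfLine ≤ 1) :
    ∃ u : ℝ≥0 → ℝ≥0, ∀ x, 0 < x → h x = u x := by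
  refine ⟨fun x => (h x).toNNReal, fun x hx => (ENNReal.coe_toNNReal fun htop => ?_).symm⟩
  have := (mul_add_mul_add_mul_le_lintegral hh (le_refl x) (le_refl x)).trans hint
  simp [htop, ENNReal.top_mul, hx.ne'] at this

/-- A decreasing function with values `α = 1 / P₁`, `β = 1 / P₂` and `γ > 1 / Q` at points
`P ≤ P₁ < P₂ < Q ≤ 3P/2` has a lower Riemann sum, hence an integral, exceeding `1`. -/
theorem not_short_chain {P P₁ P₂ Q α β γ : ℝ} (h0 : 0 < P) (h1 : P ≤ P₁) (h2 : P₁ < P₂)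
    (h3 : P₂ < Q) (h4 : 2 * Q ≤ 3 * P) (hα : α * P₁ = 1) (hβ : β * P₂ = 1) (hγ : 1 < γ * Q)
    (h : α * P + β * (P₁ - P) + γ * (P₂ - P₁) ≤ 1) : False := by
  have hQ : 0 < Q := by linarith
  have l1 : (P₂ - P₁) * 1 < (P₂ - P₁) * (γ * Q) := mul_lt_mul_of_pos_left hγ (by linarith)
  have l2 := mul_le_mul_of_nonneg_right h hQ.le
  have l3 : α * P * Q + β * (P₁ - P) * Q + (P₂ - P₁) < Q := by linarith
  have hPP : P * P ≤ P₁ * P₂ := mul_le_mul h1 (by linarith) h0.le (by linarith)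
  have hPP0 : 0 < P₁ * P₂ := (mul_pos h0 h0).trans_le hPP
  have l4 := mul_lt_mul_of_pos_left l3 hPP0
  have l5 : P₁ * P₂ * (α * P * Q + β * (P₁ - P) * Q + (P₂ - P₁)) =
      (α * P₁) * P₂ * P * Q + (β * P₂) * P₁ * (P₁ - P) * Q + P₁ * P₂ * (P₂ - P₁) := by ring
  rw [l5, hα, hβ] at l4
  have l6 : (P₂ - P₁) * (P₁ * P₂) < (P₂ - P₁) * (Q * (P₁ - P)) := by linarith
  have l7 := lt_of_mul_lt_mul_left l6 (by linarith)
  have l8 : Q * (P₁ - P) ≤ (3 * P / 2) * (P / 2) :=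
    mul_le_mul (by linarith) (by linarith) (by linarith) (by linarith)
  have := mul_pos h0 h0
  linarith

namespace PhiFunction

/-- On the image under `T̃` of `(p, q]` the integrand is at most `T(h(p))`, and `T̃(q) = 1 / T(1/q)`. -/
theorem setLIntegral_tilde_symm_le {T : PhiFunction} {h : ℝ≥0 → ℝ≥0∞} (hh : Antitone h)
    {p q v : ℝ≥0} (hv : h p ≤ v) :
    ∫⁻ x in Ioc (T.tilde p) (T.tilde q), T.extend (h (T.tilde.symm x)) ∂lebesgueHalfLine ≤
      ((T v / T q⁻¹ : ℝ≥0) : ℝ≥0∞) := by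
  refine (setLIntegral_Ioc_le _ _ _ (T v : ℝ≥0) fun x hx => ?_).trans ?_
  · rw [← extend_coe]
    exact T.extend_mono ((hh (T.tilde.le_symm_iff.2 hx.1.le)).trans hv)
  · rw [← ENNReal.coe_mul]
    refine ENNReal.coe_le_coe.2 ?_
    rw [div_eq_mul_inv, ← tilde_apply]
    gcongr
    exact tsub_le_self

theorem setLIntegral_tilde_symm_le_one {T : PhiFunction} {h : ℝ≥0 → ℝ≥0∞} (hh : Antitone h)
    {p q v : ℝ≥0} (hv : h p ≤ v) (hvq : v * q ≤ 1) (hq : 0 < q) :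
    ∫⁻ x in Ioc (T.tilde p) (T.tilde q), T.extend (h (T.tilde.symm x)) ∂lebesgueHalfLine ≤ 1 := by
  refine (setLIntegral_tilde_symm_le hh hv).trans ?_
  have h1 : T v ≤ T q⁻¹ := T.monotone (by rwa [← one_div, le_div_iff₀ hq])
  exact_mod_cast div_le_one_of_le₀ h1 zero_le

theorem setLIntegral_tilde_symm_split (T : PhiFunction) (h : ℝ≥0 → ℝ≥0∞) (p q r : ℝ≥0) :
    ∫⁻ x in Ioc (T.tilde p) (T.tilde r), T.extend (h (T.tilde.symm x)) ∂lebesgueHalfLine ≤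
    (∫⁻ x in Ioc (T.tilde p) (T.tilde q), T.extend (h (T.tilde.symm x)) ∂lebesgueHalfLine) +
    ∫⁻ x in Ioc (T.tilde q) (T.tilde r), T.extend (h (T.tilde.symm x)) ∂lebesgueHalfLine :=
  (lintegral_mono_set Ioc_subset_Ioc_union_Ioc).trans (lintegral_union_le _ _ _)

/-- Over a short interval the integral of `T ∘ h` against `dT̃` is bounded, whatever the growth of
`T`: three steps of the recursion `p ↦ 1 / h(p)`, each of which contributes at most `1`, lead
from `p` beyond `3p/2`. -/
theorem setLIntegral_tilde_symm_le_three {T : PhiFunction} {h : ℝ≥0 → ℝ≥0∞} (hh : Antitone h)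
    (hint : ∫⁻ x, h x ∂lebesgueHalfLine ≤ 1) {p q : ℝ≥0} (hp : 0 < p) (hpq : p ≤ q)
    (hq : 2 * q ≤ 3 * p) :
    ∫⁻ x in Ioc (T.tilde p) (T.tilde q), T.extend (h (T.tilde.symm x)) ∂lebesgueHalfLine ≤ 3 := by
  obtain ⟨u, hu⟩ := exists_eq_coe_of_antitone hh hint
  have hsum : ∀ x y z : ℝ≥0, 0 < x → x ≤ y → y ≤ z →
      u x * x + u y * (y - x) + u z * (z - y) ≤ 1 := by
    intro x y z hx hxy hyz
    have := (mul_add_mul_add_mul_le_lintegral hh hxy hyz).trans hint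
    rw [hu x hx, hu y (hx.trans_le hxy), hu z (hx.trans_le (hxy.trans hyz))] at this
    exact_mod_cast this
  have hstep : ∀ x, 0 < x → 1 < u x * q →
      x ≤ (u x)⁻¹ ∧ (u x)⁻¹ < q ∧ u x * (u x)⁻¹ = 1 := by
    intro x hx hxq
    have hux : 0 < u x := by
      rcases eq_or_ne (u x) 0 with h0 | h0
      · simp [h0] at hxq
      · exact pos_iff_ne_zero.2 h0
    have h1 := hsum x x x hx le_rfl le_rfl
    simp only [tsub_self, mul_zero, add_zero] at h1
    refine ⟨?_, ?_, mul_inv_cancel₀ hux.ne'⟩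
    · rwa [← one_div, le_div_iff₀ hux, mul_comm]
    · rwa [← one_div, div_lt_iff₀ hux, mul_comm]
  have hone : ∀ x y, 0 < x → x ≤ y → u x * y ≤ 1 →
      ∫⁻ t in Ioc (T.tilde x) (T.tilde y), T.extend (h (T.tilde.symm t)) ∂lebesgueHalfLine ≤ 1 :=
    fun x y hx hxy h1 => setLIntegral_tilde_symm_le_one hh (hu x hx).le h1 (hx.trans_le hxy)
  rcases le_or_gt (u p * q) 1 with h1 | h1
  · exact (hone p q hp hpq h1).trans (by norm_num)
  obtain ⟨hpp₁, hp₁q, hup⟩ := hstep p hp h1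
  set p₁ := (u p)⁻¹
  have hp₁ : 0 < p₁ := hp.trans_le hpp₁
  have c1 := hone p p₁ hp hpp₁ hup.le
  rcases le_or_gt (u p₁ * q) 1 with h2 | h2
  · calc _ ≤ _ := T.setLIntegral_tilde_symm_split h p p₁ q
      _ ≤ 1 + 1 := add_le_add c1 (hone p₁ q hp₁ hp₁q.le h2)
      _ ≤ 3 := by norm_num
  obtain ⟨hp₁₂, hp₂q, hup₁⟩ := hstep p₁ hp₁ h2
  set p₂ := (u p₁)⁻¹
  have hp₂ : 0 < p₂ := hp₁.trans_le hp₁₂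
  have c2 := hone p₁ p₂ hp₁ hp₁₂ hup₁.le
  have c3 : ∫⁻ t in Ioc (T.tilde p₂) (T.tilde q), T.extend (h (T.tilde.symm t))
      ∂lebesgueHalfLine ≤ 1 := by
    rcases hp₁₂.eq_or_lt with heq | hlt
    · -- Here `h` has spent its whole integral on `[0, p₁]`.
      refine (setLIntegral_Ioc_le _ _ _ 0 fun t ht => ?_).trans (by simp)
      have ht' : p₂ < T.tilde.symm t := by
        rw [← T.tilde.lt_iff, T.tilde.apply_symm]; exact ht.1
      have h3 := hsum p₁ _ _ hp₁ (hp₁₂.trans ht'.le) le_rfl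
      rw [show u p₁ * p₁ = 1 by nth_rewrite 2 [heq]; exact hup₁] at h3
      have h4 : u (T.tilde.symm t) * (T.tilde.symm t - p₁) = 0 := by
        simpa using h3
      have h5 : T.tilde.symm t - p₁ ≠ 0 := by
        rw [heq]; exact (tsub_pos_of_lt ht').ne'
      rw [hu _ (hp₂.trans ht'), (mul_eq_zero.1 h4).resolve_right h5, extend_coe, T.map_zero]
      simp
    · refine hone p₂ q hp₂ hp₂q.le ?_
      by_contra! h3
      have h4 := hsum p p₁ p₂ hp hpp₁ hp₁₂
      have h4' : (u p * p + u p₁ * (p₁ - p) + u p₂ * (p₂ - p₁) : ℝ) ≤ 1 := by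
        rw [← NNReal.coe_sub hpp₁, ← NNReal.coe_sub hp₁₂]
        exact_mod_cast h4
      have hup' : (u p * p₁ : ℝ) = 1 := by exact_mod_cast hup
      have hup₁' : (u p₁ * p₂ : ℝ) = 1 := by exact_mod_cast hup₁
      have h3' : (1 : ℝ) < u p₂ * q := by exact_mod_cast h3
      have k1 : (p : ℝ) ≤ p₁ := by exact_mod_cast hpp₁
      have k2 : (p₁ : ℝ) < p₂ := by exact_mod_cast hlt
      have k3 : (p₂ : ℝ) < q := by exact_mod_cast hp₂q
      have k4 : (2 * q : ℝ) ≤ 3 * p := by exact_mod_cast hq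
      have k0 : (0 : ℝ) < p := by exact_mod_cast hp
      exact not_short_chain k0 k1 k2 k3 k4 hup' hup₁' h3' h4'
  calc _ ≤ _ := T.setLIntegral_tilde_symm_split h p p₁ q
    _ ≤ 1 + (1 + 1) := add_le_add c1
        ((T.setLIntegral_tilde_symm_split h p₁ p₂ q).trans (add_le_add c2 c3))
    _ ≤ 3 := by norm_num

/-- In the cell of `(a ^ (-n-1), a ^ (-n)]`, with `v = h(a ^ (-n-1))`, the integral is bounded by
`T(v) / T(a ^ n)`, to which the control of ratios applies if `v ≤ a ^ n`; otherwise `v / a ^ n ≥ 1`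
absorbs the bound `3`. The sum of `v / a ^ n` is a lower Riemann sum of `h`. -/
theorem SummablyControlled.exists_lintegral_le {T : PhiFunction} (hT : T.SummablyControlled) :
    ∃ C : ℝ≥0, ∀ h : ℝ≥0 → ℝ≥0∞, Antitone h → ∫⁻ x, h x ∂lebesgueHalfLine ≤ 1 →
      ∫⁻ x, T.extend (h (T.tilde.symm x)) ∂lebesgueHalfLine ≤ C := by
  set a : ℝ≥0 := 3 / 2 with ha_def
  have ha : 1 < a := by rw [ha_def, lt_div_iff₀ two_pos]; norm_num
  have ha0 : 0 < a := one_pos.trans ha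
  obtain ⟨C, e, he, hC⟩ := hT a ha
  refine ⟨(C + 3) * (a * (1 - a⁻¹)⁻¹ + ∑' n, e n), fun h hh hint => ?_⟩
  obtain ⟨u, hu⟩ := exists_eq_coe_of_antitone hh hint
  have hpos : ∀ n : ℤ, 0 < a ^ n := fun n => zpow_pos ha0 n
  have hδ : 0 < 1 - a⁻¹ := tsub_pos_of_lt (inv_lt_one_of_one_lt₀ ha)
  have hcell : ∀ n : ℤ, ∫⁻ x in Ioc (T.tilde (a ^ (-(n + 1)))) (T.tilde (a ^ (-n))),
      T.extend (h (T.tilde.symm x)) ∂lebesgueHalfLine ≤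
        (((C + 3) * (u (a ^ (-(n + 1))) / a ^ n + e n) : ℝ≥0) : ℝ≥0∞) := by
    intro n
    rcases le_total (u (a ^ (-(n + 1)))) (a ^ n) with hle | hle
    · refine (setLIntegral_tilde_symm_le hh (hu _ (hpos _)).le).trans (ENNReal.coe_le_coe.2 ?_)
      rw [← zpow_neg, neg_neg, div_le_iff₀ (T.pos (hpos n))]
      refine (hC n _ hle).trans ?_
      gcongr
      exact le_self_add
    · refine (setLIntegral_tilde_symm_le_three hh hint (hpos _)
        (zpow_le_zpow_right₀ ha.le (by omega)) ?_).trans ?_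
      · rw [neg_add, zpow_add₀ ha0.ne', zpow_neg_one, ha_def]
        apply le_of_eq
        field_simp
      · have h1 : 1 ≤ u (a ^ (-(n + 1))) / a ^ n := by rwa [one_le_div₀ (hpos n)]
        have h2 : (3 : ℝ≥0) ≤ (C + 3) * (u (a ^ (-(n + 1))) / a ^ n + e n) :=
          calc (3 : ℝ≥0) = 3 * 1 := by norm_num
            _ ≤ _ := mul_le_mul' le_add_self (h1.trans le_self_add)
        exact_mod_cast h2
  have hsum : ∑' n : ℤ, ((u (a ^ (-(n + 1))) / a ^ n : ℝ≥0) : ℝ≥0∞) ≤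
      ((a * (1 - a⁻¹)⁻¹ : ℝ≥0) : ℝ≥0∞) := by
    have h1 := (tsum_zpow_le_lintegral h (fun s t _ hst => hh hst) ha).trans hint
    rw [← (Equiv.addRight (1 : ℤ)).tsum_eq] at h1
    simp only [Equiv.coe_addRight] at h1
    calc _ = ∑' n : ℤ, ((a * (1 - a⁻¹)⁻¹ : ℝ≥0) : ℝ≥0∞) *
          (h (a ^ (-(n + 1))) * ((a ^ (-(n + 1)) * (1 - a⁻¹) : ℝ≥0) : ℝ≥0∞)) := by
          refine tsum_congr fun n => ?_
          rw [hu _ (hpos _), ← ENNReal.coe_mul, ← ENNReal.coe_mul, ENNReal.coe_inj]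
          rw [show a ^ (-(n + 1)) * (1 - a⁻¹) = (a ^ n)⁻¹ * a⁻¹ * (1 - a⁻¹) by
            rw [neg_add, zpow_add₀ ha0.ne', zpow_neg_one, zpow_neg]]
          have hx := hδ.ne'
          generalize 1 - a⁻¹ = δ at hx
          generalize u _ = U
          have := (hpos n).ne'
          field_simp
      _ = ((a * (1 - a⁻¹)⁻¹ : ℝ≥0) : ℝ≥0∞) * _ := ENNReal.tsum_mul_left
      _ ≤ _ := mul_le_of_le_one_right' h1
  calc _ ≤ ∑' n : ℤ, ∫⁻ x in Ioc (T.tilde (a ^ (-(n + 1)))) (T.tilde (a ^ (-n))),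
      T.extend (h (T.tilde.symm x)) ∂lebesgueHalfLine := by
        refine lintegral_le_tsum_Ioc _ (fun n => T.tilde (a ^ (-n))) fun t ht => ?_
        obtain ⟨n, hn⟩ := exists_mem_Ioc_zpow_neg ha (T.tilde.symm.pos ht)
        refine ⟨n, ?_, ?_⟩
        · rw [← T.tilde.apply_symm t, T.tilde.lt_iff]; exact hn.1
        · rw [← T.tilde.apply_symm t, T.tilde.le_iff]; exact hn.2
    _ ≤ ∑' n : ℤ, (((C + 3) * (u (a ^ (-(n + 1))) / a ^ n + e n) : ℝ≥0) : ℝ≥0∞) :=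
        ENNReal.tsum_le_tsum hcell
    _ = ((C + 3 : ℝ≥0) : ℝ≥0∞) * (∑' n : ℤ, ((u (a ^ (-(n + 1))) / a ^ n : ℝ≥0) : ℝ≥0∞) +
          ∑' n, (e n : ℝ≥0∞)) := by
        rw [← ENNReal.tsum_add, ← ENNReal.tsum_mul_left]
        exact tsum_congr fun n => by push_cast; rfl
    _ ≤ ((C + 3 : ℝ≥0) : ℝ≥0∞) * (((a * (1 - a⁻¹)⁻¹ : ℝ≥0) : ℝ≥0∞) + ∑' n, (e n : ℝ≥0∞)) := by
        gcongr
    _ = _ := by rw [← ENNReal.coe_tsum he, ← ENNReal.coe_add, ← ENNReal.coe_mul]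

theorem Dilatory.extend_div_le {G : PhiFunction} {c M : ℝ≥0} (hM : 0 < M) (hc : 1 ≤ c)
    (h : ∀ t, M * G t ≤ G (c * t)) (u : ℝ≥0∞) :
    G.extend (u / c) ≤ (M : ℝ≥0∞)⁻¹ * G.extend u := by
  have hc0 : 0 < c := one_pos.trans_le hc
  induction u using ENNReal.recTopCoe with
  | top => simp [ENNReal.mul_top]
  | coe t =>
    rw [← ENNReal.coe_div hc0.ne', extend_coe, extend_coe, ← ENNReal.coe_inv hM.ne',
      ← ENNReal.coe_mul, ENNReal.coe_le_coe, ← div_eq_inv_mul, le_div_iff₀ hM, mul_comm]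
    simpa [mul_div_cancel₀ t hc0.ne'] using h (t / c)

/-- The substitution `h = G₂ ∘ f* ∘ F̃ ∘ G̃₂⁻¹` turns the integral for `G₁` into the integral of
`T ∘ h ∘ T̃⁻¹` with `T = G₁ ∘ G₂⁻¹`; a bound on it becomes a bound on the functional because `G₁`
is dilatory. -/
theorem exists_orliczLorentz_le (F : PhiFunction) {G₁ G₂ : PhiFunction}
    (hT : (G₁.comp G₂.symm).SummablyControlled) (h₁ : G₁.Dilatory) :
    ∃ c : ℝ≥0, ∀ f : ℝ≥0 → ℂ,
      orliczLorentz lebesgueHalfLine F G₁ f ≤ c * orliczLorentz lebesgueHalfLine F G₂ f := by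
  obtain ⟨C, hC⟩ := hT.exists_lintegral_le
  obtain ⟨c, hc1, hc⟩ := h₁.exists_mul_le (C + 1)
  have hc0 : 0 < c := one_pos.trans_le hc1
  refine ⟨c, fun f => ?_⟩
  have hcE : (c : ℝ≥0∞) ≠ 0 := by exact_mod_cast hc0.ne'
  rw [mul_comm, ← ENNReal.div_le_iff hcE ENNReal.coe_ne_top]
  refine le_iInf fun d => le_iInf fun hd => le_iInf fun hint => ?_
  rw [ENNReal.div_le_iff hcE ENNReal.coe_ne_top, ← ENNReal.coe_mul]
  refine iInf_le_of_le (d * c) (iInf_le_of_le (mul_pos hd hc0) (iInf_le_of_le ?_ le_rfl))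
  set D : ℝ≥0 → ℝ≥0∞ := fun s =>
    rearrangement lebesgueHalfLine f (F.tilde s) / (d : ℝ≥0∞) with hD
  have hDanti : Antitone D := fun s t hst =>
    ENNReal.div_le_div_right (rearrangement_antitone _ _ (F.tilde.monotone hst)) _
  have h1 := hC (fun x => G₂.extend (D (G₂.tilde.symm x)))
    (fun x y hxy => G₂.extend_mono (hDanti (G₂.tilde.symm.monotone hxy))) hint
  simp only [comp_symm_tilde_symm, symm_apply, extend_comp_symm] at h1
  calc _ ≤ ∫⁻ x, ((C + 1 : ℝ≥0) : ℝ≥0∞)⁻¹ * G₁.extend (D (G₁.tilde.symm x))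
        ∂lebesgueHalfLine := by
        refine lintegral_mono fun x => ?_
        have h2 := Dilatory.extend_div_le (by positivity) hc1 hc (D (G₁.tilde.symm x))
        refine le_trans (le_of_eq ?_) h2
        simp only [hD, ENNReal.coe_mul, ENNReal.div_eq_inv_mul]
        rw [ENNReal.mul_inv (Or.inr ENNReal.coe_ne_top) (Or.inr hcE), mul_comm (d : ℝ≥0∞)⁻¹,
          mul_assoc]
    _ = ((C + 1 : ℝ≥0) : ℝ≥0∞)⁻¹ * ∫⁻ x, G₁.extend (D (G₁.tilde.symm x)) ∂lebesgueHalfLine := by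
        refine lintegral_const_mul' _ _ ?_
        simp
    _ ≤ ((C + 1 : ℝ≥0) : ℝ≥0∞)⁻¹ * ((C + 1 : ℝ≥0) : ℝ≥0∞) := by
        gcongr
        exact h1.trans (ENNReal.coe_le_coe.2 le_self_add)
    _ ≤ 1 := ENNReal.inv_mul_le_one _

theorem AlmostConvex.dilatory {T : PhiFunction} (hT : T.AlmostConvex) : T.Dilatory := by
  obtain ⟨a, b, N, ha, hb, hN, h⟩ := hT
  have ha0 : 0 < a := one_pos.trans ha
  obtain ⟨hfin, -⟩ := h (N + 1) (by omega)
  -- Finitely many exceptions are absorbed by a longer step, as `T` tends to infinity.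
  have hlong : ∃ M : ℕ, N + 1 ≤ M ∧ ∀ n : ℤ, a * T (a ^ n) ≤ T (a ^ (n + (M : ℤ))) := by
    have hev : ∀ n : ℤ, ∀ᶠ M : ℕ in atTop, a * T (a ^ n) ≤ T (a ^ (n + (M : ℤ))) := by
      intro n
      have h1 : Tendsto (fun M : ℕ => a ^ (n + (M : ℤ))) atTop atTop := by
        have h2 := (tendsto_pow_atTop_atTop_of_one_lt ha).const_mul_atTop (zpow_pos ha0 n)
        refine h2.congr fun M => ?_
        rw [zpow_add₀ ha0.ne', zpow_natCast]
      exact (T.tendsto_atTop'.comp h1).eventually_ge_atTop _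
    have hev' := (hfin.eventually_all (l := atTop)).2 fun n _ => hev n
    obtain ⟨M, hM, hM'⟩ := (hev'.and (eventually_ge_atTop (N + 1))).exists
    refine ⟨M, hM', fun n => ?_⟩
    by_cases hn : a ^ (((N + 1 : ℕ) : ℤ) - (N : ℤ)) * T (a ^ n) ≤ T (a ^ (n + ((N + 1 : ℕ) : ℤ)))
    · have h3 : (((N + 1 : ℕ) : ℤ) - (N : ℤ)) = 1 := by push_cast; ring
      rw [h3, zpow_one] at hn
      exact hn.trans (T.monotone (zpow_le_zpow_right₀ ha.le (by omega)))
    · exact hM n hn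
  obtain ⟨M, hM, hlong⟩ := hlong
  refine ⟨a ^ (M + 1), a, one_lt_pow₀ ha (by omega), ha, fun t => ?_⟩
  rcases eq_or_ne t 0 with rfl | ht
  · simp [T.map_zero]
  obtain ⟨n, hn1, hn2⟩ := exists_mem_Ioc_zpow (pos_iff_ne_zero.2 ht) ha
  calc a * T t ≤ a * T (a ^ (n + 1)) := by gcongr; exact T.monotone hn2
    _ ≤ T (a ^ (n + 1 + (M : ℤ))) := hlong _
    _ ≤ _ := by
      refine T.monotone ?_
      rw [add_assoc, zpow_add₀ ha0.ne', mul_comm,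
        show (1 + (M : ℤ)) = ((M + 1 : ℕ) : ℤ) by push_cast; ring, zpow_natCast]
      gcongr

theorem Dilatory.of_comp_symm {G₁ G₂ : PhiFunction} (hT : (G₁.comp G₂.symm).Dilatory)
    (h₂ : G₂.Dilatory) : G₁.Dilatory := by
  obtain ⟨c₁, c₂, h1, h2, h⟩ := hT
  obtain ⟨c, hc1, hc⟩ := h₂.exists_mul_le c₁
  have key : ∀ t, c₂ * G₁ t ≤ G₁ (c * t) := by
    intro t
    have h3 := h (G₂ t)
    simp only [comp_apply, symm_apply] at h3
    refine h3.trans (G₁.monotone ?_)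
    rw [symm_le_iff]
    exact hc t
  refine ⟨c, c₂, hc1.lt_of_ne ?_, h2, key⟩
  rintro rfl
  have h3 := key 1
  rw [one_mul] at h3
  exact absurd h3 (not_le.2 (lt_mul_of_one_lt_left (G₁.pos one_pos) h2))

end PhiFunction

/-! ### Necessity: step functions with separated levels -/

/-- The decreasing step function `sup {v i | i ∈ S, x ≤ X i}`. -/
noncomputable def stepFun {ι : Type*} (S : Finset ι) (v X : ι → ℝ≥0) (x : ℝ≥0) : ℝ≥0 :=
  {i ∈ S | x ≤ X i}.sup v

section StepFun

variable {ι : Type*} (S : Finset ι) (v X : ι → ℝ≥0)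

theorem stepFun_antitone : Antitone (stepFun S v X) := by
  intro x y hxy
  refine Finset.sup_mono fun i hi => ?_
  rw [Finset.mem_filter] at hi ⊢
  exact ⟨hi.1, hxy.trans hi.2⟩

variable {S v X}

theorem le_stepFun {i : ι} (hi : i ∈ S) {x : ℝ≥0} (hx : x ≤ X i) : v i ≤ stepFun S v X x :=
  Finset.le_sup (f := v) (Finset.mem_filter.2 ⟨hi, hx⟩)

/-- At `x = 0` the rearrangement takes the value `∞`, whence the restriction to `x > 0`. -/
theorem rearrangement_stepFun {x : ℝ≥0} (hx : 0 < x) :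
    rearrangement lebesgueHalfLine (fun x => ((stepFun S v X x : ℝ) : ℂ)) x = stepFun S v X x := by
  have hn : ∀ ω, ‖((stepFun S v X ω : ℝ) : ℂ)‖₊ = stepFun S v X ω := by
    intro ω
    rw [Complex.nnnorm_real]
    simp
  apply le_antisymm
  · refine iSup_le fun t => iSup_le fun h => ?_
    rw [ENNReal.coe_le_coe]
    by_contra! hlt
    have ht : 0 < t := lt_of_le_of_lt zero_le hlt
    have hlast : {i ∈ S | t ≤ v i}.sup X < x := by
      rw [Finset.sup_lt_iff hx]
      intro i hi
      rw [Finset.mem_filter] at hi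
      by_contra! hxi
      exact absurd (hi.2.trans (le_stepFun hi.1 hxi)) (not_le.2 hlt)
    have hsub : {ω | t ≤ ‖((stepFun S v X ω : ℝ) : ℂ)‖₊} ⊆ Iic ({i ∈ S | t ≤ v i}.sup X) := by
      intro ω hω
      rw [mem_ofPred_eq, hn, stepFun, Finset.le_sup_iff ht] at hω
      obtain ⟨i, hi, hti⟩ := hω
      rw [Finset.mem_filter] at hi
      exact hi.2.trans (Finset.le_sup (f := X) (Finset.mem_filter.2 ⟨hi.1, hti⟩))
    have h2 := h.trans (measure_mono hsub)
    rw [lebesgueHalfLine_Iic, ENNReal.coe_le_coe] at h2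
    exact absurd hlast (not_lt.2 h2)
  · refine le_iSup₂_of_le (stepFun S v X x) ?_ le_rfl
    rw [← lebesgueHalfLine_Iic]
    refine measure_mono fun ω hω => ?_
    rw [mem_ofPred_eq, hn]
    exact stepFun_antitone S v X hω

end StepFun

namespace PhiFunction

/-- On families of pairs `(zᵢ, yᵢ)` for which the values `T(yᵢ)` are separated by factors `2`,
smallness of `∑ zᵢ / yᵢ` bounds `∑ T(zᵢ) / T(yᵢ)`. -/
def SparselyControlled (T : PhiFunction) : Prop :=
  ∃ B : ℝ≥0, 1 ≤ B ∧ ∀ (ι : Type) (S : Finset ι) (z y : ι → ℝ≥0), (∀ i ∈ S, 0 < y i) →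
    (∀ i ∈ S, ∀ j ∈ S, i ≠ j → 2 * T (y i) ≤ T (y j) ∨ 2 * T (y j) ≤ T (y i)) →
    ∑ i ∈ S, z i / y i ≤ B⁻¹ → ∑ i ∈ S, T (z i) / T (y i) ≤ B

/-- Under either `Δ₂`-condition, dividing by a constant inside `G₁ ∘ G₂⁻¹` can be undone by
constants outside. -/
theorem exists_le_mul_of_delta2 {G₁ G₂ : PhiFunction} (hΔ : G₁.Delta2 ∨ G₂.Delta2) {c : ℝ≥0}
    (hc : 0 < c) : ∃ (C₁ C₂ : ℝ≥0) (V : ℝ≥0 → ℝ≥0), 1 ≤ C₁ ∧ 1 ≤ C₂ ∧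
      ∀ z, G₂ (V z) = C₁ * z ∧ G₁.comp G₂.symm z ≤ C₂ * G₁ (V z / c) := by
  rcases hΔ with hΔ | hΔ
  · obtain ⟨C, hC1, hC⟩ := hΔ.exists_mul_le c
    refine ⟨1, C, G₂.symm, le_rfl, hC1, fun z => ⟨by rw [G₂.apply_symm, one_mul], ?_⟩⟩
    have h := hC (G₁ (G₂.symm z / c))
    rwa [symm_apply, mul_div_cancel₀ _ hc.ne', le_symm_iff] at h
  · obtain ⟨C, hC1, hC⟩ := hΔ.exists_mul_le c
    refine ⟨C, 1, fun z => G₂.symm (C * z), hC1, le_rfl, fun z => ⟨G₂.apply_symm _, ?_⟩⟩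
    rw [one_mul, comp_apply, G₁.le_iff, le_div_iff₀ hc, mul_comm]
    exact hC z

/-- The comparison of the functionals, tested on step functions whose `i`-th step has its end at the
point corresponding to `1 / yᵢ` and its height corresponding to `zᵢ`. -/
theorem sparselyControlled_of_orliczLorentz_le (F : PhiFunction) {G₁ G₂ : PhiFunction}
    (hΔ : G₁.Delta2 ∨ G₂.Delta2)
    (h : ∃ c : ℝ≥0, ∀ f : ℝ≥0 → ℂ, Measurable f →
      orliczLorentz lebesgueHalfLine F G₁ f ≤ c * orliczLorentz lebesgueHalfLine F G₂ f) :
    (G₁.comp G₂.symm).SparselyControlled := by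
  obtain ⟨c, h⟩ := h
  set T := G₁.comp G₂.symm
  obtain ⟨C₁, C₂, V, hC1, hC2, hV⟩ := exists_le_mul_of_delta2 hΔ (c := c + 1) (by positivity)
  have hC10 : 0 < C₁ := one_pos.trans_le hC1
  refine ⟨C₁ + 2 * C₂, hC1.trans le_self_add, fun ι S z y hy hsep hsum => ?_⟩
  set X : ι → ℝ≥0 := fun i => F.tilde (G₂.tilde.symm (y i)⁻¹) with hX
  set st := stepFun S (fun i => V (z i)) X with hst
  set f : ℝ≥0 → ℂ := fun x => ((st x : ℝ) : ℂ)
  have hfm : Measurable f := by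
    have : Measurable st := (stepFun_antitone _ _ _).measurable
    exact Complex.measurable_ofReal.comp (measurable_coe_nnreal_real.comp this)
  have hre : ∀ {x}, 0 < x → rearrangement lebesgueHalfLine f x = st x :=
    fun hx => rearrangement_stepFun hx
  have hpos : ∀ G : PhiFunction, ∀ {x}, 0 < x → 0 < F.tilde (G.tilde.symm x) :=
    fun G x hx => F.tilde.pos (G.tilde.symm.pos hx)
  have hsum' : ∑ i ∈ S, C₁ * z i * (y i)⁻¹ ≤ 1 := by
    calc _ = C₁ * ∑ i ∈ S, z i / y i := by
          rw [Finset.mul_sum]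
          exact Finset.sum_congr rfl fun i _ => by rw [div_eq_mul_inv, mul_assoc]
      _ ≤ C₁ * C₁⁻¹ := by
          gcongr
          exact hsum.trans (inv_anti₀ hC10 le_self_add)
      _ = 1 := mul_inv_cancel₀ hC10.ne'
  have hnorm₂ : orliczLorentz lebesgueHalfLine F G₂ f ≤ 1 := by
    refine iInf_le_of_le 1 (iInf_le_of_le one_pos (iInf_le_of_le ?_ (by simp)))
    have hae : ∀ᵐ x ∂lebesgueHalfLine, x ≠ 0 :=
      measure_mono_null (fun x hx => by simpa using hx) lebesgueHalfLine_singleton_zero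
    calc _ ≤ ∫⁻ x, ∑ i ∈ S, (Iic (y i)⁻¹).indicator
            (fun _ => ((C₁ * z i : ℝ≥0) : ℝ≥0∞)) x ∂lebesgueHalfLine := by
          refine lintegral_mono_ae (hae.mono fun x hx => ?_)
          have hx0 : 0 < x := pos_iff_ne_zero.2 hx
          beta_reduce
          rw [hre (hpos _ hx0), ENNReal.coe_one, div_one, extend_coe]
          rcases Finset.eq_empty_or_nonempty {i ∈ S | F.tilde (G₂.tilde.symm x) ≤ X i}
            with he | hne
          · rw [hst, stepFun, he]
            simp [G₂.map_zero]
          · obtain ⟨i, hi, hi'⟩ := Finset.exists_mem_eq_sup _ hne fun i => V (z i)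
            rw [hst, stepFun, hi', (hV _).1]
            rw [Finset.mem_filter] at hi
            have hxi : x ≤ (y i)⁻¹ := by
              have := hi.2
              rwa [hX, F.tilde.le_iff, G₂.tilde.symm.le_iff] at this
            refine le_trans (le_of_eq ?_) (Finset.single_le_sum (fun _ _ => zero_le) hi.1)
            rw [indicator_of_mem (mem_Iic.2 hxi)]
      _ = ∑ i ∈ S, ((C₁ * z i * (y i)⁻¹ : ℝ≥0) : ℝ≥0∞) := by
          rw [lintegral_finsetSum S fun i _ => measurable_const.indicator measurableSet_Iic]
          refine Finset.sum_congr rfl fun i _ => ?_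
          rw [lintegral_indicator_const measurableSet_Iic, lebesgueHalfLine_Iic,
            ENNReal.coe_mul _ (y i)⁻¹]
      _ ≤ 1 := by exact_mod_cast hsum'
  have hnorm₁ : orliczLorentz lebesgueHalfLine F G₁ f < ((c + 1 : ℝ≥0) : ℝ≥0∞) := by
    calc _ ≤ c * orliczLorentz lebesgueHalfLine F G₂ f := h f hfm
      _ ≤ c * 1 := by gcongr
      _ = c := mul_one _
      _ < _ := by exact_mod_cast lt_add_one c
  have hint : ∫⁻ x, G₁.extend (rearrangement lebesgueHalfLine f (F.tilde (G₁.tilde.symm x)) /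
      ((c + 1 : ℝ≥0) : ℝ≥0∞)) ∂lebesgueHalfLine ≤ 1 := by
    rw [orliczLorentz, luxemburg] at hnorm₁
    simp only [iInf_lt_iff] at hnorm₁
    obtain ⟨d, hd, hd', hlt⟩ := hnorm₁
    refine le_trans (lintegral_mono fun x => G₁.extend_mono ?_) hd'
    exact ENNReal.div_le_div_left hlt.le _
  -- The cells belonging to distinct indices are disjoint, and the integrand is at least
  -- `T(zᵢ) / C₂` on the `i`-th one.
  set A : ι → Set ℝ≥0 := fun i => Ioc (2 * T (y i))⁻¹ (T (y i))⁻¹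
  have hTpos : ∀ i ∈ S, 0 < T (y i) := fun i hi => T.pos (hy i hi)
  have hdisj : (S : Set ι).PairwiseDisjoint A := by
    intro i hi j hj hij
    rcases hsep i hi j hj hij with hle | hle
    · refine (Ioc_disjoint_Ioc_of_le ?_).symm
      exact inv_anti₀ (mul_pos two_pos (hTpos i hi)) hle
    · refine Ioc_disjoint_Ioc_of_le ?_
      exact inv_anti₀ (mul_pos two_pos (hTpos j hj)) hle
  have hlow : ∑ i ∈ S, ((T (z i) / C₂ * (2 * T (y i))⁻¹ : ℝ≥0) : ℝ≥0∞) ≤ 1 := by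
    calc _ ≤ ∑ i ∈ S, ∫⁻ x in A i, G₁.extend (rearrangement lebesgueHalfLine f
            (F.tilde (G₁.tilde.symm x)) / ((c + 1 : ℝ≥0) : ℝ≥0∞)) ∂lebesgueHalfLine := by
          refine Finset.sum_le_sum fun i hi => ?_
          have hlen : (T (y i))⁻¹ - (2 * T (y i))⁻¹ = (2 * T (y i))⁻¹ := by
            rw [tsub_eq_iff_eq_add_of_le
              (inv_anti₀ (hTpos i hi) (le_mul_of_one_le_left zero_le one_le_two))]
            have := (hTpos i hi).ne'
            field_simp
            norm_num
          rw [ENNReal.coe_mul]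
          nth_rewrite 1 [← hlen]
          refine le_setLIntegral_Ioc _ _ _ _ fun x hx => ?_
          have hx0 : 0 < x := lt_of_le_of_lt zero_le hx.1
          rw [hre (hpos _ hx0), ← ENNReal.coe_div (by positivity), extend_coe,
            ENNReal.coe_le_coe, div_le_iff₀ (one_pos.trans_le hC2), mul_comm]
          refine (hV (z i)).2.trans ?_
          gcongr
          refine G₁.monotone ?_
          gcongr
          refine le_stepFun (v := fun i => V (z i)) hi ?_
          refine F.tilde.monotone ?_
          rw [tilde_symm_apply, tilde_symm_apply, inv_inv]
          refine inv_anti₀ (G₂.symm.pos (hy i hi)) ?_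
          rw [le_symm_iff]
          exact le_inv_of_le_inv₀ hx0 hx.2
      _ = ∫⁻ x in ⋃ i ∈ S, A i, G₁.extend (rearrangement lebesgueHalfLine f
            (F.tilde (G₁.tilde.symm x)) / ((c + 1 : ℝ≥0) : ℝ≥0∞)) ∂lebesgueHalfLine :=
          (lintegral_biUnion_finset hdisj (fun _ _ => measurableSet_Ioc) _).symm
      _ ≤ _ := setLIntegral_le_lintegral _ _
      _ ≤ 1 := hint
  have hlow' : ∑ i ∈ S, T (z i) / C₂ * (2 * T (y i))⁻¹ ≤ 1 := by exact_mod_cast hlow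
  calc ∑ i ∈ S, T (z i) / T (y i) = 2 * C₂ * ∑ i ∈ S, T (z i) / C₂ * (2 * T (y i))⁻¹ := by
        rw [Finset.mul_sum]
        refine Finset.sum_congr rfl fun i hi => ?_
        have := (hTpos i hi).ne'
        have := (one_pos.trans_le hC2).ne'
        field_simp
    _ ≤ 2 * C₂ * 1 := by gcongr
    _ ≤ _ := by rw [mul_one]; exact le_add_self

/-- If `T` grows by less than the factor `2` on arbitrarily long intervals, then arbitrarily many
such intervals can be found whose values of `T` are separated: in a bounded part of `(0,∞)` there
is no room for longer and longer ones. -/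
theorem exists_flat_family {T : PhiFunction}
    (hflat : ∀ l : ℝ≥0, 1 < l → ∃ t, T (l * t) < 2 * T t) {l : ℝ≥0} (hl : 1 < l) (k : ℕ) :
    ∃ S : Finset (ℝ≥0 × ℝ≥0), S.card = k ∧
      (∀ p ∈ S, 0 < p.2 ∧ l * p.1 ≤ p.2 ∧ T p.2 < 2 * T p.1) ∧
      ∀ p ∈ S, ∀ q ∈ S, p ≠ q → 2 * T p.2 ≤ T q.2 ∨ 2 * T q.2 ≤ T p.2 := by
  induction k with
  | zero => exact ⟨∅, by simp⟩
  | succ k ih =>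
    obtain ⟨S, hcard, hS, hsep⟩ := ih
    set M := S.sup fun p => T p.2
    set m : ℝ≥0 := ((S.sup fun p => (T p.2)⁻¹) + 1)⁻¹
    have hm0 : 0 < m := by positivity
    have hMle : ∀ p ∈ S, T p.2 ≤ M := fun p hp => Finset.le_sup (f := fun p => T p.2) hp
    have hmle : ∀ p ∈ S, m ≤ T p.2 := fun p hp => by
      refine inv_le_of_inv_le₀ (T.pos (hS p hp).1) (le_trans ?_ le_self_add)
      exact Finset.le_sup (f := fun p => (T p.2)⁻¹) hp
    set s := T.symm (m / 4) with hs
    have hs0 : 0 < s := T.symm.pos (by positivity)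
    obtain ⟨t, ht⟩ := hflat (max l (T.symm (2 * M) / s)) (lt_max_of_lt_left hl)
    set L := max l (T.symm (2 * M) / s)
    have ht0 : 0 < t := by
      rcases eq_or_ne t 0 with h0 | h0
      · simp [h0, T.map_zero] at ht
      · exact pos_iff_ne_zero.2 h0
    have hnew : ∀ p ∈ S, 2 * T p.2 ≤ T (L * t) ∨ 2 * T (L * t) ≤ T p.2 := by
      intro p hp
      rcases le_total (2 * M) (T (L * t)) with h1 | h1
      · left
        exact le_trans (by gcongr; exact hMle p hp) h1
      · right
        have h2 : L * t ≤ L * s := by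
          calc L * t ≤ T.symm (2 * M) := T.le_symm_iff.2 h1
            _ = T.symm (2 * M) / s * s := by rw [div_mul_cancel₀ _ hs0.ne']
            _ ≤ _ := by gcongr; exact le_max_right _ _
        have h3 : t ≤ s := le_of_mul_le_mul_left h2 (one_pos.trans (lt_max_of_lt_left hl))
        calc 2 * T (L * t) ≤ 2 * (2 * T t) := by gcongr
          _ ≤ 2 * (2 * T s) := by gcongr; exact T.monotone h3
          _ = m := by rw [hs, T.apply_symm]; ring_nf
          _ ≤ _ := hmle p hp
    have hLt : 0 < L * t := mul_pos (one_pos.trans (lt_max_of_lt_left hl)) ht0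
    have hnot : (t, L * t) ∉ S := by
      intro hmem
      have h4 : 2 * T (L * t) ≤ 1 * T (L * t) := by simpa using hnew _ hmem
      exact absurd (le_of_mul_le_mul_right h4 (T.pos hLt)) (by norm_num)
    refine ⟨Finset.cons (t, L * t) S hnot, by rw [Finset.card_cons, hcard], ?_, ?_⟩
    · intro p hp
      rcases Finset.mem_cons.1 hp with rfl | hp
      · exact ⟨hLt, by change l * t ≤ L * t; gcongr; exact le_max_left _ _, ht⟩
      · exact hS p hp
    · intro p hp q hq hpq
      rcases Finset.mem_cons.1 hp with rfl | hp <;> rcases Finset.mem_cons.1 hq with rfl | hq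
      · exact absurd rfl hpq
      · exact (hnew q hq).symm
      · exact hnew p hp
      · exact hsep p hp q hq hpq

theorem SparselyControlled.exists_two_mul_le {T : PhiFunction} (hT : T.SparselyControlled) :
    ∃ l : ℝ≥0, 1 < l ∧ ∀ t, 2 * T t ≤ T (l * t) := by
  by_contra! hflat
  obtain ⟨B, hB, h⟩ := hT
  have hB0 : 0 < B := one_pos.trans_le hB
  obtain ⟨k, hk⟩ := exists_nat_gt (2 * B)
  have hk1 : 1 ≤ (k : ℝ≥0) := (hB.trans (le_mul_of_one_le_left zero_le one_le_two)).trans hk.le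
  have hl1 : 1 < (k : ℝ≥0) * B + 1 := lt_add_of_pos_left _ (by positivity)
  obtain ⟨S, hcard, hS, hsep⟩ := exists_flat_family hflat hl1 k
  have h1 := h _ S Prod.fst Prod.snd (fun p hp => (hS p hp).1) hsep (by
    calc ∑ p ∈ S, p.1 / p.2 ≤ ∑ _p ∈ S, ((k : ℝ≥0) * B)⁻¹ := by
          refine Finset.sum_le_sum fun p hp => ?_
          rw [div_le_iff₀ (hS p hp).1, le_inv_mul_iff₀ (by positivity)]
          exact le_trans (by gcongr; exact le_self_add) (hS p hp).2.1
      _ = B⁻¹ := by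
          rw [Finset.sum_const, hcard, nsmul_eq_mul]
          have := (one_pos.trans_le hk1).ne'
          field_simp)
  have h2 : (k : ℝ≥0) * 2⁻¹ ≤ ∑ p ∈ S, T p.1 / T p.2 := by
    calc (k : ℝ≥0) * 2⁻¹ = ∑ _p ∈ S, 2⁻¹ := by rw [Finset.sum_const, hcard, nsmul_eq_mul]
      _ ≤ _ := by
        refine Finset.sum_le_sum fun p hp => ?_
        rw [le_div_iff₀ (T.pos (hS p hp).1), inv_mul_le_iff₀ two_pos]
        exact (hS p hp).2.2.le
  have h3 : 2 * B < 2 * B := by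
    calc 2 * B < k := hk
      _ = 2 * (k * 2⁻¹) := by field_simp
      _ ≤ 2 * B := by gcongr; exact h2.trans h1
  exact lt_irrefl _ h3

theorem SparselyControlled.almostConvex {T : PhiFunction} (hT : T.SparselyControlled) :
    T.AlmostConvex := by
  obtain ⟨a, ha, hdil⟩ := hT.exists_two_mul_le
  obtain ⟨B, hB, h⟩ := hT
  have ha0 : 0 < a := one_pos.trans ha
  have hB0 : 0 < B := one_pos.trans_le hB
  obtain ⟨N, hN⟩ := pow_unbounded_of_one_lt (2 * B ^ 2) ha
  refine ⟨a, a, N + 1, ha, by exact_mod_cast ha, by omega, fun m hm => ?_⟩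
  set V := {n : ℤ | ¬ (a ^ ((m : ℤ) - ((N + 1 : ℕ) : ℤ)) * T (a ^ n) ≤
      T (a ^ (n + (m : ℤ))))} with hV
  have hpos : ∀ n : ℤ, 0 < a ^ n := fun n => zpow_pos ha0 n
  rcases lt_or_ge (a ^ m) B with hmB | hmB
  · have hmN : m < N := by
      rw [← pow_lt_pow_iff_right₀ ha]
      refine hmB.trans_le (le_trans ?_ hN.le)
      calc B ≤ B ^ 2 := le_self_pow₀ hB two_ne_zero
        _ ≤ _ := le_mul_of_one_le_left zero_le one_le_two
    have hVe : V = ∅ := by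
      rw [eq_empty_iff_forall_notMem]
      intro n hn
      refine hn ?_
      have h1 : a ^ ((m : ℤ) - ((N + 1 : ℕ) : ℤ)) ≤ 1 := zpow_le_one_of_nonpos₀ ha.le (by omega)
      exact (mul_le_of_le_one_left zero_le h1).trans
        (T.monotone (zpow_le_zpow_right₀ ha.le (by omega)))
    rw [hVe]
    simp only [finite_empty, ncard_empty, true_and]
    exact_mod_cast pow_pos ha0 m
  · -- A set of `a ^ m / B` exceptions is small enough for the control to apply to it.
    set q := ⌊a ^ m / B⌋₊
    have hq1 : 1 ≤ q := Nat.le_floor (by rw [Nat.cast_one, one_le_div hB0]; exact hmB)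
    have hqle : (q : ℝ≥0) ≤ a ^ m / B := Nat.floor_le zero_le
    have hqgt : a ^ m / B < q + 1 := Nat.lt_floor_add_one _
    have hnone : ¬ ∃ s : Finset ℤ, (s : Set ℤ) ⊆ V ∧ s.card = q := by
      rintro ⟨s, hsV, hsc⟩
      have hsep' : ∀ i j : ℤ, i < j → 2 * T (a ^ (i + (m : ℤ))) ≤ T (a ^ (j + (m : ℤ))) := by
        intro i j hij
        refine (hdil _).trans (T.monotone ?_)
        rw [← zpow_one_add₀ ha0.ne']
        exact zpow_le_zpow_right₀ ha.le (by omega)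
      have h1 := h ℤ s (fun n => a ^ n) (fun n => a ^ (n + (m : ℤ))) (fun n _ => hpos _)
        (fun i _ j _ hij => (lt_or_gt_of_ne hij).imp (hsep' i j) (hsep' j i)) (by
          calc ∑ n ∈ s, a ^ n / a ^ (n + (m : ℤ)) = ∑ _n ∈ s, (a ^ m)⁻¹ := by
                refine Finset.sum_congr rfl fun n _ => ?_
                rw [zpow_add₀ ha0.ne', zpow_natCast]
                have := (hpos n).ne'
                field_simp
            _ = q * (a ^ m)⁻¹ := by rw [Finset.sum_const, hsc, nsmul_eq_mul]
            _ ≤ a ^ m / B * (a ^ m)⁻¹ := by gcongr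
            _ = B⁻¹ := by field_simp)
      have h2 : (q : ℝ≥0) * (a ^ N / a ^ m) ≤ B := by
        calc (q : ℝ≥0) * (a ^ N / a ^ m) = ∑ _n ∈ s, a ^ N / a ^ m := by
              rw [Finset.sum_const, hsc, nsmul_eq_mul]
          _ ≤ ∑ n ∈ s, T (a ^ n) / T (a ^ (n + (m : ℤ))) := by
              refine Finset.sum_le_sum fun n hn => ?_
              have h3 := hsV hn
              rw [hV, mem_ofPred_eq, not_le] at h3
              rw [le_div_iff₀ (T.pos (hpos _))]
              calc a ^ N / a ^ m * T (a ^ (n + (m : ℤ)))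
                  ≤ a ^ N / a ^ m * (a ^ ((m : ℤ) - ((N + 1 : ℕ) : ℤ)) * T (a ^ n)) := by
                    gcongr
                _ = a⁻¹ * T (a ^ n) := by
                    rw [zpow_sub₀ ha0.ne', zpow_natCast, zpow_natCast, pow_succ]
                    field_simp
                _ ≤ T (a ^ n) := mul_le_of_le_one_left zero_le (inv_le_one_of_one_le₀ ha.le)
          _ ≤ B := h1
      have h4 : a ^ m ≤ 2 * q * B := by
        rw [div_lt_iff₀ hB0] at hqgt
        refine hqgt.le.trans ?_
        gcongr
        rw [two_mul]
        gcongr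
        exact_mod_cast hq1
      have h5 : a ^ N ≤ 2 * B ^ 2 := by
        have hq0 : (0 : ℝ≥0) < q := by exact_mod_cast hq1
        refine le_of_mul_le_mul_left ?_ hq0
        calc (q : ℝ≥0) * a ^ N = q * (a ^ N / a ^ m) * a ^ m := by field_simp
          _ ≤ B * (2 * q * B) := by gcongr
          _ = _ := by ring
      exact absurd hN (not_lt.2 h5)
    have hfin : V.Finite := by
      by_contra hinf
      obtain ⟨s, hs⟩ := Set.Infinite.exists_subset_card_eq hinf q
      exact hnone ⟨s, hs⟩
    have hcard : V.ncard < q := by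
      by_contra! hle
      rw [Set.ncard_eq_toFinset_card _ hfin] at hle
      obtain ⟨s, hs, hsc⟩ := Finset.exists_subset_card_eq hle
      refine hnone ⟨s, fun n hn => ?_, hsc⟩
      simpa using hs hn
    refine ⟨hfin, ?_⟩
    have h6 : (V.ncard : ℝ≥0) < a ^ m := by
      calc (V.ncard : ℝ≥0) < q := by exact_mod_cast hcard
        _ ≤ a ^ m / B := hqle
        _ ≤ a ^ m := div_le_self zero_le hB
    exact_mod_cast h6

end PhiFunction

/-! ### Comparable grids -/

namespace PhiFunction

/-- The quotient `G₁ / G₂` decreases by a factor of at most `a ^ N` between the grid points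
`A n` and `A (n + m)`. -/
def GridRatioLE (G₁ G₂ : PhiFunction) (a : ℝ≥0) (N : ℕ) (A : ℤ → ℝ≥0) (m : ℕ) (n : ℤ) : Prop :=
  G₂ (A (n + m)) * G₁ (A n) ≤ a ^ N * (G₁ (A (n + m)) * G₂ (A n))

/-- `G₁` is almost more convex than `G₂`, as seen along the grid `A`. -/
def AlmostMoreConvexOn (G₁ G₂ : PhiFunction) (a : ℝ≥0) (A : ℤ → ℝ≥0) : Prop :=
  ∃ (b : ℝ) (N : ℕ), 1 < b ∧ 1 ≤ N ∧ ∀ m : ℕ, 1 ≤ m →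
    {n : ℤ | ¬ GridRatioLE G₁ G₂ a N A m n}.Finite ∧
    ({n : ℤ | ¬ GridRatioLE G₁ G₂ a N A m n}.ncard : ℝ) < b ^ m

theorem almostMoreConvex_iff {G₁ G₂ : PhiFunction} :
    G₁.AlmostMoreConvex G₂ ↔ ∃ a : ℝ≥0, 1 < a ∧ AlmostMoreConvexOn G₁ G₂ a (fun n => a ^ n) := by
  have key : ∀ (a : ℝ≥0) (N m : ℕ) (n : ℤ), 1 < a →
      (G₂ (a ^ (n + (m : ℤ))) / G₂ (a ^ n) ≤ a ^ N * (G₁ (a ^ (n + (m : ℤ))) / G₁ (a ^ n)) ↔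
        GridRatioLE G₁ G₂ a N (fun n => a ^ n) m n) := by
    intro a N m n ha
    have hp : 0 < a ^ n := zpow_pos (one_pos.trans ha) n
    rw [GridRatioLE, div_le_iff₀ (G₂.pos hp)]
    rw [show a ^ N * (G₁ (a ^ (n + (m : ℤ))) / G₁ (a ^ n)) * G₂ (a ^ n) =
      (a ^ N * (G₁ (a ^ (n + (m : ℤ))) * G₂ (a ^ n))) / G₁ (a ^ n) by ring,
      le_div_iff₀ (G₁.pos hp)]
  constructor
  · rintro ⟨a, b, N, ha, hb, hN, h⟩
    refine ⟨a, ha, b, N, hb, hN, fun m hm => ?_⟩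
    simpa only [key a N m _ ha] using h m hm
  · rintro ⟨a, ha, b, N, hb, hN, h⟩
    refine ⟨a, b, N, ha, hb, hN, fun m hm => ?_⟩
    simpa only [key a N m _ ha] using h m hm

theorem almostConvex_comp_symm_iff {G₁ G₂ : PhiFunction} :
    (G₁.comp G₂.symm).AlmostConvex ↔
      ∃ a : ℝ≥0, 1 < a ∧ AlmostMoreConvexOn G₁ G₂ a (fun n => G₂.symm (a ^ n)) := by
  have key : ∀ (a : ℝ≥0) (N m : ℕ) (n : ℤ), 1 < a →
      (a ^ ((m : ℤ) - (N : ℤ)) * G₁.comp G₂.symm (a ^ n) ≤ G₁.comp G₂.symm (a ^ (n + (m : ℤ))) ↔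
        GridRatioLE G₁ G₂ a N (fun n => G₂.symm (a ^ n)) m n) := by
    intro a N m n ha
    have ha0 : 0 < a := one_pos.trans ha
    have hp : 0 < a ^ n := zpow_pos ha0 n
    rw [GridRatioLE, comp_apply, comp_apply, apply_symm, apply_symm,
      ← mul_le_mul_iff_right₀ (a := a ^ N * a ^ n) (by positivity)]
    rw [show a ^ N * a ^ n * (a ^ ((m : ℤ) - (N : ℤ)) * G₁ (G₂.symm (a ^ n))) =
        a ^ (n + (m : ℤ)) * G₁ (G₂.symm (a ^ n)) by
      rw [zpow_sub₀ ha0.ne', zpow_add₀ ha0.ne', zpow_natCast, zpow_natCast]; field_simp,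
      show a ^ N * a ^ n * G₁ (G₂.symm (a ^ (n + (m : ℤ)))) =
        a ^ N * (G₁ (G₂.symm (a ^ (n + (m : ℤ)))) * a ^ n) by ring]
  constructor
  · rintro ⟨a, b, N, ha, hb, hN, h⟩
    refine ⟨a, ha, b, N, hb, hN, fun m hm => ?_⟩
    simpa only [key a N m _ ha] using h m hm
  · rintro ⟨a, ha, b, N, hb, hN, h⟩
    refine ⟨a, b, N, ha, hb, hN, fun m hm => ?_⟩
    simpa only [key a N m _ ha] using h m hm

/-- Two grids whose cells are comparable, with constant `κ`, see the same almost convexity: a bad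
pair of points of `A` contains a bad pair of points of `B`, at most `κ` times as many cells apart,
and each point of `B` arises from at most `κ` points of `A`. -/
theorem AlmostMoreConvexOn.of_comparable {G₁ G₂ : PhiFunction} {a : ℝ≥0} (ha : 1 < a)
    {A B : ℤ → ℝ≥0} (hA : Monotone A) (hB : StrictMono B) {κ : ℕ} (hκ : 1 ≤ κ)
    (hAB : ∀ n, ∃ k, B k < A n ∧ A n ≤ B (k + 1))
    (h₁ : ∀ n k, A n ≤ B k → A (n + 1) ≤ B (k + κ))
    (h₂ : ∀ n k, B k < A n → B (k + 1) < A (n + κ))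
    (hG : ∀ k, G₂ (B (k + 1)) ≤ a ^ κ * G₂ (B k))
    (h : AlmostMoreConvexOn G₁ G₂ a B) : AlmostMoreConvexOn G₁ G₂ a A := by
  obtain ⟨b, N, hb, hN, h⟩ := h
  choose σ hσ₁ hσ₂ using hAB
  have hσmono : Monotone σ := by
    intro n n' hn
    have := hB.lt_iff_lt.1 ((hσ₁ n).trans_le ((hA hn).trans (hσ₂ n')))
    omega
  have hσup : ∀ (n : ℤ) (m : ℕ), σ (n + m) ≤ σ n + κ * m := by
    intro n m
    induction m with
    | zero => simp
    | succ m ih =>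
      have := hB.lt_iff_lt.1 ((hσ₁ (n + m + 1)).trans_le (h₁ _ _ (hσ₂ (n + m))))
      push_cast
      rw [← add_assoc]
      linarith
  have hσlow : ∀ n, σ n + 1 ≤ σ (n + κ) := by
    intro n
    have := hB.lt_iff_lt.1 ((h₂ _ _ (hσ₁ n)).trans_le (hσ₂ (n + κ)))
    omega
  have hbad : ∀ (m : ℕ) (n : ℤ), ¬ GridRatioLE G₁ G₂ a (N + 2 * κ) A m n →
      ∃ m' ∈ Finset.Icc 1 (κ * m), ¬ GridRatioLE G₁ G₂ a N B m' (σ n + 1) := by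
    intro m n hn
    have hu : G₂ (B (σ n + 1)) ≤ a ^ κ * G₂ (A n) :=
      (hG _).trans (by gcongr; exact G₂.monotone (hσ₁ n).le)
    rcases le_or_gt (σ (n + m)) (σ n + 1) with hle | hlt
    · exfalso
      apply hn
      have h3 : G₂ (A (n + m)) ≤ a ^ κ * (a ^ κ * G₂ (A n)) := by
        calc G₂ (A (n + m)) ≤ G₂ (B (σ (n + m) + 1)) := G₂.monotone (hσ₂ _)
          _ ≤ G₂ (B (σ n + 1 + 1)) := G₂.monotone (hB.monotone (by omega))
          _ ≤ a ^ κ * G₂ (B (σ n + 1)) := hG _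
          _ ≤ _ := by gcongr
      have h4 : G₁ (A n) ≤ G₁ (A (n + m)) := G₁.monotone (hA (by omega))
      calc G₂ (A (n + m)) * G₁ (A n) ≤ a ^ κ * (a ^ κ * G₂ (A n)) * G₁ (A (n + m)) := by gcongr
        _ = a ^ (2 * κ) * (G₁ (A (n + m)) * G₂ (A n)) := by ring
        _ ≤ _ := by gcongr; exacts [ha.le, by omega]
    · obtain ⟨m', hm'⟩ : ∃ m' : ℕ, σ (n + m) = σ n + 1 + m' :=
        ⟨(σ (n + m) - (σ n + 1)).toNat, by omega⟩
      have hup := hσup n m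
      refine ⟨m', Finset.mem_Icc.2 ⟨by omega, ?_⟩, fun hgood => hn ?_⟩
      · have : (m' : ℤ) ≤ ((κ * m : ℕ) : ℤ) := by push_cast; linarith
        exact_mod_cast this
      · rw [GridRatioLE, ← hm'] at hgood
        have hv : G₂ (A (n + m)) ≤ a ^ κ * G₂ (B (σ (n + m))) :=
          (G₂.monotone (hσ₂ _)).trans (hG _)
        have hu' : G₁ (A n) ≤ G₁ (B (σ n + 1)) := G₁.monotone (hσ₂ n)
        have hv' : G₁ (B (σ (n + m))) ≤ G₁ (A (n + m)) := G₁.monotone (hσ₁ _).le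
        calc G₂ (A (n + m)) * G₁ (A n)
            ≤ a ^ κ * G₂ (B (σ (n + m))) * G₁ (B (σ n + 1)) := by gcongr
          _ = a ^ κ * (G₂ (B (σ (n + m))) * G₁ (B (σ n + 1))) := by ring
          _ ≤ a ^ κ * (a ^ N * (G₁ (B (σ (n + m))) * G₂ (B (σ n + 1)))) := by gcongr
          _ ≤ a ^ κ * (a ^ N * (G₁ (A (n + m)) * (a ^ κ * G₂ (A n)))) := by gcongr
          _ = _ := by ring
  refine ⟨2 * κ ^ 2 * b ^ κ, N + 2 * κ, ?_, by omega, fun m hm => ?_⟩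
  · have h5 : (1 : ℝ) ≤ b ^ κ := one_le_pow₀ hb.le
    have h6 : (1 : ℝ) ≤ (κ : ℝ) ^ 2 := one_le_pow₀ (by exact_mod_cast hκ)
    nlinarith
  set U : Set ℤ := ⋃ m' ∈ Finset.Icc 1 (κ * m), {n : ℤ | ¬ GridRatioLE G₁ G₂ a N B m' n}
  set V : Set ℤ := {n : ℤ | ¬ GridRatioLE G₁ G₂ a (N + 2 * κ) A m n}
  have hUfin : U.Finite :=
    (Finset.Icc 1 (κ * m)).finite_toSet.biUnion fun m' hm' => (h m' (Finset.mem_Icc.1 hm').1).1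
  have hUcard : (U.ncard : ℝ) ≤ (κ * m : ℕ) * b ^ (κ * m) := by
    calc (U.ncard : ℝ) ≤ ((∑ m' ∈ Finset.Icc 1 (κ * m),
          {n : ℤ | ¬ GridRatioLE G₁ G₂ a N B m' n}.ncard : ℕ) : ℝ) := by
          exact_mod_cast Finset.set_ncard_biUnion_le _ _
      _ ≤ ∑ m' ∈ Finset.Icc 1 (κ * m), b ^ (κ * m) := by
          push_cast
          refine Finset.sum_le_sum fun m' hm' => ?_
          rw [Finset.mem_Icc] at hm'
          exact (h m' hm'.1).2.le.trans (pow_le_pow_right₀ hb.le hm'.2)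
      _ = _ := by rw [Finset.sum_const, nsmul_eq_mul, Nat.card_Icc, Nat.add_sub_cancel]
  -- Points of `A` with the same image under `σ` are less than `κ` apart, hence are told apart by
  -- their residues modulo `κ`.
  set g : ℤ → ℤ × ℤ := fun n => (σ n + 1, n % κ) with hg
  have hκ0 : (0 : ℤ) < κ := by exact_mod_cast hκ
  have hginj : Function.Injective g := by
    have hlt : ∀ n n' : ℤ, σ n = σ n' → n' < n + κ := by
      intro n n' he
      by_contra! hle
      have := hσmono hle
      have := hσlow n
      omega
    intro n n' he
    simp only [hg, Prod.mk.injEq, add_left_inj] at he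
    have e1 := hlt n n' he.1
    have e2 := hlt n' n he.1.symm
    obtain ⟨c, hc⟩ : (κ : ℤ) ∣ n' - n := Int.ModEq.dvd he.2
    have hc1 : c < 1 := by
      by_contra! hge
      nlinarith
    have hc2 : -1 < c := by
      by_contra! hge
      nlinarith
    have : c = 0 := by omega
    subst this
    linarith
  have himg : g '' V ⊆ U ×ˢ Ico (0 : ℤ) κ := by
    rintro _ ⟨n, hn, rfl⟩
    refine ⟨?_, Int.emod_nonneg _ hκ0.ne', Int.emod_lt_of_pos _ hκ0⟩
    obtain ⟨m', hm', hb'⟩ := hbad m n hn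
    exact mem_biUnion hm' hb'
  have hprod : (U ×ˢ Ico (0 : ℤ) κ).Finite := hUfin.prod (finite_Ico _ _)
  refine ⟨(hprod.subset himg).of_finite_image hginj.injOn, ?_⟩
  have hcard : V.ncard ≤ U.ncard * κ := by
    rw [← ncard_image_of_injective V hginj]
    refine (ncard_le_ncard himg hprod).trans (le_of_eq ?_)
    rw [ncard_prod, ← Finset.coe_Ico, ncard_coe_finset, Int.card_Ico]
    simp
  have hκ1 : (1 : ℝ) ≤ κ := by exact_mod_cast hκ
  calc (V.ncard : ℝ) ≤ U.ncard * κ := by exact_mod_cast hcard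
    _ ≤ (κ * m : ℕ) * b ^ (κ * m) * κ := by gcongr
    _ = m * κ ^ 2 * (b ^ κ) ^ m := by push_cast; ring
    _ < 2 ^ m * κ ^ 2 * (b ^ κ) ^ m := by
        gcongr
        exact_mod_cast Nat.lt_two_pow_self
    _ ≤ 2 ^ m * (κ ^ 2) ^ m * (b ^ κ) ^ m := by
        gcongr
        exact le_self_pow₀ (one_le_pow₀ hκ1) (by omega)
    _ = _ := by rw [mul_pow, mul_pow]

theorem exists_growth_bounds {G : PhiFunction} (h : G.Dilatory) (hΔ : G.Delta2) {a : ℝ≥0}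
    (ha : 1 < a) :
    ∃ κ : ℕ, 1 ≤ κ ∧ (∀ t, a * G t ≤ G (a ^ κ * t)) ∧ ∀ t, G (a * t) ≤ a ^ κ * G t := by
  obtain ⟨c, -, hc⟩ := h.exists_mul_le a
  obtain ⟨d, -, hd⟩ := hΔ.exists_mul_le a
  obtain ⟨i, hi⟩ := pow_unbounded_of_one_lt (max c d) ha
  have hi' : max c d ≤ a ^ (i + 1) := hi.le.trans (pow_le_pow_right₀ ha.le (by omega))
  refine ⟨i + 1, by omega, fun t => ?_, fun t => ?_⟩
  · refine (hc t).trans (G.monotone ?_)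
    gcongr
    exact (le_max_left _ _).trans hi'
  · have h1 := hd (G t)
    rw [symm_apply, le_symm_iff] at h1
    refine h1.trans ?_
    gcongr
    exact (le_max_right _ _).trans hi'

theorem almostConvex_iff_almostMoreConvex {G₁ G₂ : PhiFunction} (h : G₂.Dilatory)
    (hΔ : G₂.Delta2) : (G₁.comp G₂.symm).AlmostConvex ↔ G₁.AlmostMoreConvex G₂ := by
  rw [almostConvex_comp_symm_iff, almostMoreConvex_iff]
  refine exists_congr fun a => and_congr_right fun ha => ?_
  obtain ⟨κ, hκ, hκ₁, hκ₂⟩ := exists_growth_bounds h hΔ ha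
  have ha0 : 0 < a := one_pos.trans ha
  have hmono : StrictMono fun n : ℤ => a ^ n := zpow_right_strictMono₀ ha
  have hadd : ∀ (n : ℤ), a ^ (n + (κ : ℤ)) = a ^ κ * a ^ n := fun n => by
    rw [zpow_add₀ ha0.ne', zpow_natCast, mul_comm]
  have hone : ∀ (n : ℤ), a ^ (n + 1) = a * a ^ n := fun n => by
    rw [zpow_add_one₀ ha0.ne', mul_comm]
  -- `gcongr` takes this bound from the context.
  have hκa : a ≤ a ^ κ := le_self_pow₀ ha.le (by omega)
  constructor
  · refine AlmostMoreConvexOn.of_comparable ha hmono.monotone (G₂.symm.strictMono.comp hmono) hκ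
      ?_ ?_ ?_ ?_
    · intro n
      obtain ⟨k, hk₁, hk₂⟩ := exists_mem_Ioc_zpow (G₂.pos (zpow_pos ha0 n)) ha
      refine ⟨k, ?_, G₂.le_symm_iff.2 hk₂⟩
      rw [← G₂.lt_iff, G₂.apply_symm]
      exact hk₁
    · intro n k hnk
      simp only [le_symm_iff, hadd, hone] at hnk ⊢
      exact (hκ₂ _).trans (by gcongr)
    · intro n k hnk
      simp only [hadd, hone] at hnk ⊢
      rw [← G₂.lt_iff, G₂.apply_symm] at hnk ⊢
      refine lt_of_lt_of_le ?_ (hκ₁ _)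
      gcongr
    · intro k
      simp only [apply_symm, hone]
      gcongr
  · refine AlmostMoreConvexOn.of_comparable ha (G₂.symm.strictMono.comp hmono).monotone hmono hκ
      ?_ ?_ ?_ ?_
    · intro n
      exact exists_mem_Ioc_zpow (G₂.symm.pos (zpow_pos ha0 n)) ha
    · intro n k hnk
      simp only [symm_le_iff, hadd, hone] at hnk ⊢
      exact le_trans (by gcongr) (hκ₁ _)
    · intro n k hnk
      simp only [hadd, hone] at hnk ⊢
      rw [← G₂.lt_iff, G₂.apply_symm] at hnk ⊢
      exact (hκ₂ _).trans_lt (by gcongr)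
    · intro k
      simp only [hone]
      exact hκ₂ _

end PhiFunction

/-! ### Construction of the `N`-function from nodes -/

namespace PhiFunction

/-- If `M(t) / t` is increasing up to a constant, then `M` is equivalent to the convex function
`t ↦ sup_s (M(s) / s) (t - s)₊`. -/
theorem exists_convexOn_equivalent {M : PhiFunction} {C : ℝ≥0}
    (hM : ∀ s t, s ≤ t → M s * t ≤ C * (M t * s)) :
    ∃ V : PhiFunction, ConvexOn ℝ≥0 univ V ∧ M.Equivalent V := by
  have hC1 : 1 ≤ C := by
    have h := hM 1 1 le_rfl
    rw [mul_one] at h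
    exact one_le_of_le_mul_right₀ (M.pos one_pos) h
  have hC0 : 0 < C := one_pos.trans_le hC1
  have hratio : ∀ s t, s ≤ t → 0 < t → M s / s ≤ C * (M t / t) := by
    intro s t hst ht
    rcases eq_or_ne s 0 with rfl | hs
    · simp
    · rw [div_le_iff₀ (pos_iff_ne_zero.2 hs), show C * (M t / t) * s = C * (M t * s) / t by ring,
        le_div_iff₀ ht]
      exact hM s t hst
  set V : ℝ≥0 → ℝ≥0 := fun t => ⨆ s, M s / s * (t - s)
  have hterm : ∀ s t, M s / s * (t - s) ≤ C * M t := by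
    intro s t
    rcases le_total t s with hts | hst
    · simp [tsub_eq_zero_of_le hts]
    · rcases eq_or_ne t 0 with rfl | ht
      · simp
      have ht0 := pos_iff_ne_zero.2 ht
      calc M s / s * (t - s) ≤ C * (M t / t) * t := by
            gcongr
            · exact hratio s t hst ht0
            · exact tsub_le_self
        _ = C * M t := by field_simp
  have hbdd : ∀ t, BddAbove (range fun s => M s / s * (t - s)) := fun t =>
    ⟨C * M t, by rintro _ ⟨s, rfl⟩; exact hterm s t⟩
  have hle : ∀ s t, M s / s * (t - s) ≤ V t := fun s t => le_ciSup (hbdd t) s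
  have hVle : ∀ t, V t ≤ C * M t := fun t => ciSup_le' fun s => hterm s t
  have hleV : ∀ t, M (2⁻¹ * t) ≤ V t := by
    intro t
    rcases eq_or_ne t 0 with rfl | ht
    · simp [M.map_zero]
    refine le_trans (le_of_eq ?_) (hle (2⁻¹ * t) t)
    have h2 : t - 2⁻¹ * t = 2⁻¹ * t := by
      rw [tsub_eq_iff_eq_add_of_le (mul_le_of_le_one_left zero_le (by norm_num))]
      ring_nf
    rw [h2]
    field_simp
  have hconv : ConvexOn ℝ≥0 univ V := by
    refine ⟨convex_univ, fun x _ y _ l k _ _ hlk => ciSup_le' fun s => ?_⟩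
    simp only [smul_eq_mul]
    calc M s / s * (l * x + k * y - s) ≤ M s / s * (l * (x - s) + k * (y - s)) := by
          gcongr
          rw [tsub_le_iff_right]
          calc l * x + k * y ≤ l * (x - s + s) + k * (y - s + s) := by
                gcongr <;> exact le_tsub_add
            _ = l * (x - s) + k * (y - s) + (l + k) * s := by ring
            _ = _ := by rw [hlk, one_mul]
      _ = l * (M s / s * (x - s)) + k * (M s / s * (y - s)) := by ring
      _ ≤ _ := by gcongr <;> exact hle _ _
  have hV0 : V 0 = 0 := by
    have := hVle 0
    rwa [M.map_zero, mul_zero, nonpos_iff_eq_zero] at this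
  have hstrict : StrictMono V := by
    intro x y hxy
    have hy : 0 < y := lt_of_le_of_lt zero_le hxy
    have hVy : 0 < V y := (M.pos (by positivity)).trans_le (hleV y)
    have hl : x / y < 1 := (div_lt_one hy).2 hxy
    have h0 := hconv.2
    have h1 := h0 (mem_univ y) (mem_univ 0) (a := x / y) (b := 1 - x / y) zero_le zero_le
      (add_tsub_cancel_of_le hl.le)
    simp only [smul_eq_mul, mul_zero, add_zero, hV0, div_mul_cancel₀ x hy.ne'] at h1
    exact h1.trans_lt (mul_lt_of_lt_one_left hVy hl)
  have hcont : Continuous V := by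
    have hlip : ∀ R : ℝ≥0, 0 < R →
        LipschitzOnWith (C * (M R / R)) (fun t => (V t : ℝ)) (Iic R) := by
      intro R hR
      refine LipschitzOnWith.of_le_add_mul _ fun y hy x _ => ?_
      rcases le_total y x with hyx | hxy
      · have h1 : (V y : ℝ) ≤ V x := by exact_mod_cast hstrict.monotone hyx
        have h2 : 0 ≤ ((C * (M R / R) : ℝ≥0) : ℝ) * dist y x := by positivity
        linarith
      · have h1 : V y ≤ V x + C * (M R / R) * (y - x) := by
          refine ciSup_le' fun s => ?_
          rcases le_total y s with hys | hsy
          · simp [tsub_eq_zero_of_le hys]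
          calc M s / s * (y - s) ≤ M s / s * ((x - s) + (y - x)) := by
                gcongr
                rw [tsub_le_iff_right]
                calc y ≤ x + (y - x) := le_add_tsub
                  _ ≤ (x - s + s) + (y - x) := by gcongr; exact le_tsub_add
                  _ = _ := by ring
            _ = M s / s * (x - s) + M s / s * (y - x) := by ring
            _ ≤ _ := by
              gcongr
              · exact hle s x
              · exact hratio s R (hsy.trans hy) hR
        have h2 : dist y x = ((y - x : ℝ≥0) : ℝ) := by
          rw [NNReal.dist_eq, NNReal.coe_sub hxy, abs_of_nonneg]
          exact sub_nonneg.2 (by exact_mod_cast hxy)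
        rw [h2]
        exact_mod_cast h1
    rw [NNReal.isEmbedding_coe.continuous_iff, continuous_iff_continuousAt]
    intro x
    exact (hlip (x + 1) (by positivity)).continuousOn.continuousAt
      (Iic_mem_nhds (lt_add_one x))
  have htop : Tendsto V atTop atTop :=
    tendsto_atTop_mono hleV (M.tendsto_atTop'.comp
      (tendsto_id.const_mul_atTop (by positivity)))
  refine ⟨⟨V, hV0, htop, hstrict, hcont⟩, hconv, 2 * C ^ 2, by positivity, fun t => ⟨?_, ?_⟩⟩
  · refine (M.monotone ?_).trans (hleV t)
    gcongr
    exact le_mul_of_one_le_right zero_le (one_le_pow₀ hC1)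
  · rcases eq_or_ne t 0 with rfl | ht
    · simp [hV0]
    refine (hVle t).trans ?_
    have h1 := hM t (C ^ 2 * t) (le_mul_of_one_le_left zero_le (one_le_pow₀ hC1))
    have h2 : C * M t ≤ M (C ^ 2 * t) := by
      refine le_of_mul_le_mul_left ?_ (mul_pos hC0 (pos_iff_ne_zero.2 ht))
      calc C * t * (C * M t) = M t * (C ^ 2 * t) := by ring
        _ ≤ _ := h1
        _ = _ := by ring
    refine h2.trans (M.monotone ?_)
    gcongr
    exact le_mul_of_one_le_left zero_le one_le_two

/-- `N`-functions from a factorization of the identity into two `φ`-functions. -/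
theorem isNFunction_symm_of_mul_eq {φ ψ : PhiFunction} (h : ∀ t, φ t * ψ t = t) :
    φ.symm.IsNFunction := by
  have hq : (fun t : ℝ≥0 => φ.symm t / t) = fun t => ψ (φ.symm t) := by
    funext t
    rcases eq_or_ne t 0 with rfl | ht
    · simp [map_zero]
    · rw [div_eq_iff ht]
      have := h (φ.symm t)
      rw [apply_symm] at this
      rw [mul_comm, this]
  refine ⟨φ.symm, ⟨1, one_pos, fun t => by simp⟩, ?_, ?_, ?_⟩
  · rw [hq]
    exact (ψ.strictMono.comp φ.symm.strictMono).strictMonoOn _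
  · rw [hq]
    exact ψ.tendsto_atTop'.comp φ.symm.tendsto_atTop'
  · rw [hq]
    have : Tendsto (fun t => ψ (φ.symm t)) (𝓝 0) (𝓝 (ψ (φ.symm 0))) :=
      (ψ.continuous'.comp φ.symm.continuous').tendsto 0
    rw [map_zero, map_zero] at this
    exact this.mono_left nhdsWithin_le_nhds

theorem complementary_symm_symm_of_mul_eq {φ ψ : PhiFunction} (h : ∀ t, φ t * ψ t = t) :
    ψ.symm.Complementary φ.symm :=
  ⟨1, one_pos, fun t => by rw [symm_symm, symm_symm, mul_comm (ψ t), h]; simp⟩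

end PhiFunction

section Nodes

variable {Y : ℤ → ℝ≥0}

theorem two_pow_mul_le (hY : ∀ j, 2 * Y j ≤ Y (j + 1)) (j : ℤ) (k : ℕ) :
    2 ^ k * Y j ≤ Y (j + k) := by
  induction k with
  | zero => simp
  | succ k ih =>
    calc 2 ^ (k + 1) * Y j = 2 * (2 ^ k * Y j) := by ring
      _ ≤ 2 * Y (j + k) := by gcongr
      _ ≤ Y (j + k + 1) := hY _
      _ = _ := by push_cast; rw [add_assoc]

theorem strictMono_nodes (hY0 : ∀ j, 0 < Y j) (hY : ∀ j, 2 * Y j ≤ Y (j + 1)) : StrictMono Y :=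
  strictMono_int_of_lt_succ fun j =>
    (lt_mul_of_one_lt_left (hY0 j) one_lt_two).trans_le (hY j)

theorem exists_lt_node (hY0 : ∀ j, 0 < Y j) (hY : ∀ j, 2 * Y j ≤ Y (j + 1)) (y : ℝ≥0) :
    ∃ j, y < Y j := by
  obtain ⟨k, hk⟩ := pow_unbounded_of_one_lt (y / Y 0) (one_lt_two (α := ℝ≥0))
  rw [div_lt_iff₀ (hY0 0)] at hk
  exact ⟨_, hk.trans_le (two_pow_mul_le hY 0 k)⟩

theorem exists_node_le (hY : ∀ j, 2 * Y j ≤ Y (j + 1)) {y : ℝ≥0} (hy : 0 < y) :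
    ∃ j, Y j ≤ y := by
  obtain ⟨k, hk⟩ := pow_unbounded_of_one_lt (Y 0 / y) (one_lt_two (α := ℝ≥0))
  rw [div_lt_iff₀ hy] at hk
  have h := two_pow_mul_le hY (-k) k
  rw [neg_add_cancel] at h
  exact ⟨_, le_of_mul_le_mul_left (h.trans hk.le) (by positivity)⟩

theorem exists_node_le_lt (hY0 : ∀ j, 0 < Y j) (hY : ∀ j, 2 * Y j ≤ Y (j + 1)) {y : ℝ≥0}
    (hy : 0 < y) : ∃ j, Y j ≤ y ∧ y < Y (j + 1) := by
  obtain ⟨i, hi⟩ := exists_lt_node hY0 hY y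
  have hm := strictMono_nodes hY0 hY
  obtain ⟨j, hj, hmax⟩ := Int.exists_greatest_of_bdd (P := fun j => Y j ≤ y)
    ⟨i, fun j hj => (hm.lt_iff_lt.1 (lt_of_le_of_lt hj hi)).le⟩ (exists_node_le hY hy)
  refine ⟨j, hj, ?_⟩
  by_contra! hle
  have := hmax _ hle
  omega

end Nodes

theorem summable_two_inv_pow_natAbs : Summable fun j : ℤ => (2⁻¹ : ℝ≥0) ^ j.natAbs := by
  have h : Summable fun n : ℕ => (2⁻¹ : ℝ≥0) ^ n :=
    NNReal.summable_geometric (inv_lt_one_of_one_lt₀ one_lt_two)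
  rw [← NNReal.summable_coe] at h ⊢
  refine Summable.of_nat_of_neg ?_ ?_ <;> simpa using h

namespace PhiFunction

section NodeSum

variable {Y : ℤ → ℝ≥0} {A : ℝ≥0}

/-- The terms `A ^ (-j) min(y, Y j)` decay geometrically away from every index `k`: upwards because
of `A ^ (-j)`, downwards because `A ^ (-j) Y j` grows geometrically. -/
theorem nodeSum_term_le (hA : 2 ≤ A) (hY : ∀ j, 2 * A * Y j ≤ Y (j + 1)) (k j : ℤ) (y : ℝ≥0) :
    A ^ (-j) * min y (Y j) ≤ 2⁻¹ ^ (j - k).natAbs * (A ^ (-k) * (Y k + y)) := by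
  have hA0 : 0 < A := two_pos.trans_le hA
  rcases le_total j k with hjk | hkj
  · obtain ⟨i, rfl⟩ : ∃ i : ℕ, k = j + i := ⟨(k - j).toNat, by omega⟩
    have hi : (j - (j + (i : ℤ))).natAbs = i := by omega
    rw [hi]
    have hgrow : (2 * A) ^ i * Y j ≤ Y (j + i) := by
      clear hi hjk
      induction i with
      | zero => simp
      | succ i ih =>
        calc (2 * A) ^ (i + 1) * Y j = 2 * A * ((2 * A) ^ i * Y j) := by ring
          _ ≤ 2 * A * Y (j + i) := by gcongr
          _ ≤ Y (j + i + 1) := hY _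
          _ = _ := by push_cast; rw [add_assoc]
    calc A ^ (-j) * min y (Y j) ≤ A ^ (-j) * Y j := by gcongr; exact min_le_right _ _
      _ = 2⁻¹ ^ i * (A ^ (-(j + (i : ℤ))) * ((2 * A) ^ i * Y j)) := by
        rw [neg_add, zpow_add₀ hA0.ne', zpow_neg A (i : ℤ), zpow_natCast, mul_pow, inv_pow]
        field_simp
      _ ≤ _ := by gcongr; exact hgrow.trans le_self_add
  · obtain ⟨i, rfl⟩ : ∃ i : ℕ, j = k + i := ⟨(j - k).toNat, by omega⟩
    have hi : (k + (i : ℤ) - k).natAbs = i := by omega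
    rw [hi]
    calc A ^ (-(k + (i : ℤ))) * min y (Y (k + i)) ≤ A ^ (-(k + (i : ℤ))) * y := by
          gcongr; exact min_le_left _ _
      _ = A⁻¹ ^ i * (A ^ (-k) * y) := by
        rw [neg_add, zpow_add₀ hA0.ne', zpow_neg A (i : ℤ), zpow_natCast, inv_pow]
        ring
      _ ≤ _ := by
        gcongr
        exact le_add_self

theorem summable_nodeSum_bound (k : ℤ) : Summable (fun j : ℤ => (2⁻¹ : ℝ≥0) ^ (j - k).natAbs) :=
  NNReal.summable_comp_injective summable_two_inv_pow_natAbs fun i j h => by simpa using h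

/-- The concave function `y ↦ ∑ⱼ A ^ (-j) min(y, Y j)`. -/
noncomputable def nodeSum (A : ℝ≥0) (Y : ℤ → ℝ≥0) (y : ℝ≥0) : ℝ≥0 :=
  ∑' j, A ^ (-j) * min y (Y j)

theorem summable_nodeSum (hA : 2 ≤ A) (hY : ∀ j, 2 * A * Y j ≤ Y (j + 1)) (y : ℝ≥0) :
    Summable fun j => A ^ (-j) * min y (Y j) :=
  NNReal.summable_of_le (fun j => nodeSum_term_le hA hY 0 j y)
    ((summable_nodeSum_bound 0).mul_right _)

theorem nodeSum_le (hA : 2 ≤ A) (hY : ∀ j, 2 * A * Y j ≤ Y (j + 1)) (k : ℤ) (y : ℝ≥0) :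
    nodeSum A Y y ≤ (∑' j : ℤ, (2⁻¹ : ℝ≥0) ^ j.natAbs) * (A ^ (-k) * (Y k + y)) := by
  have h : ∑' j : ℤ, (2⁻¹ : ℝ≥0) ^ (j - k).natAbs = ∑' j : ℤ, (2⁻¹ : ℝ≥0) ^ j.natAbs :=
    (Equiv.subRight k).tsum_eq fun j : ℤ => (2⁻¹ : ℝ≥0) ^ j.natAbs
  rw [← h, ← NNReal.tsum_mul_right]
  exact (summable_nodeSum hA hY y).tsum_le_tsum (fun j => nodeSum_term_le hA hY k j y)
    ((summable_nodeSum_bound k).mul_right _)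

theorem le_nodeSum (hA : 2 ≤ A) (hY : ∀ j, 2 * A * Y j ≤ Y (j + 1)) (k : ℤ) (y : ℝ≥0) :
    A ^ (-k) * min y (Y k) ≤ nodeSum A Y y :=
  (summable_nodeSum hA hY y).le_tsum k fun _ _ => zero_le

theorem two_mul_node_le (hA : 2 ≤ A) (hY : ∀ j, 2 * A * Y j ≤ Y (j + 1)) (j : ℤ) :
    2 * Y j ≤ Y (j + 1) :=
  le_trans (by gcongr; exact le_mul_of_one_le_right zero_le (one_le_two.trans hA)) (hY j)

theorem nodeSum_pos (hA : 2 ≤ A) (hY0 : ∀ j, 0 < Y j) (hY : ∀ j, 2 * A * Y j ≤ Y (j + 1))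
    {y : ℝ≥0} (hy : 0 < y) : 0 < nodeSum A Y y :=
  lt_of_lt_of_le (mul_pos (zpow_pos (two_pos.trans_le hA) _) (lt_min hy (hY0 0)))
    (le_nodeSum hA hY 0 y)

theorem nodeSum_strictMono (hA : 2 ≤ A) (hY0 : ∀ j, 0 < Y j)
    (hY : ∀ j, 2 * A * Y j ≤ Y (j + 1)) : StrictMono (nodeSum A Y) := by
  intro x y hxy
  have hAp : ∀ j : ℤ, 0 < A ^ j := fun j => zpow_pos (two_pos.trans_le hA) j
  obtain ⟨j, hj⟩ := exists_lt_node hY0 (two_mul_node_le hA hY) x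
  refine NNReal.tsum_lt_tsum (i := j) (fun i => ?_) ?_ (summable_nodeSum hA hY y)
  · exact mul_le_mul' le_rfl (min_le_min_right _ hxy.le)
  · refine mul_lt_mul_of_pos_left ?_ (hAp _)
    rw [min_eq_left hj.le]
    exact lt_min hxy hj

/-- The ratio `nodeSum A Y y / y` is strictly decreasing. -/
theorem mul_nodeSum_lt (hA : 2 ≤ A) (hY0 : ∀ j, 0 < Y j) (hY : ∀ j, 2 * A * Y j ≤ Y (j + 1))
    {x y : ℝ≥0} (hx : 0 < x) (hxy : x < y) : x * nodeSum A Y y < y * nodeSum A Y x := by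
  have hAp : ∀ j : ℤ, 0 < A ^ j := fun j => zpow_pos (two_pos.trans_le hA) j
  obtain ⟨j, hj⟩ := exists_node_le (two_mul_node_le hA hY) hx
  rw [nodeSum, nodeSum, ← NNReal.tsum_mul_left, ← NNReal.tsum_mul_left]
  refine NNReal.tsum_lt_tsum (i := j) (fun i => ?_) ?_ ((summable_nodeSum hA hY x).mul_left y)
  · rw [mul_left_comm, mul_left_comm y]
    refine mul_le_mul' le_rfl ?_
    rw [mul_min_of_nonneg _ _ zero_le, mul_min_of_nonneg _ _ zero_le, mul_comm y x]
    exact min_le_min_left _ (mul_le_mul' hxy.le le_rfl)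
  · rw [mul_left_comm, mul_left_comm y, min_eq_right hj, min_eq_right (hj.trans hxy.le)]
    exact mul_lt_mul_of_pos_left (mul_lt_mul_of_pos_right hxy (hY0 j)) (hAp _)

theorem nodeSum_continuous (hA : 2 ≤ A) (hY : ∀ j, 2 * A * Y j ≤ Y (j + 1)) :
    Continuous (nodeSum A Y) := by
  rw [NNReal.isEmbedding_coe.continuous_iff, continuous_iff_continuousAt]
  intro x
  have hon : ContinuousOn (fun y => ∑' j, ((A ^ (-j) * min y (Y j) : ℝ≥0) : ℝ)) (Iic (x + 1)) := by
    refine continuousOn_tsum (u := fun j : ℤ =>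
      (((2⁻¹ : ℝ≥0) ^ (j - 0).natAbs * (A ^ (-(0 : ℤ)) * (Y 0 + (x + 1))) : ℝ≥0) : ℝ))
      (fun j => ?_) ?_ (fun j y hy => ?_)
    · exact (NNReal.continuous_coe.comp
        (continuous_const.mul (continuous_id.min continuous_const))).continuousOn
    · exact NNReal.summable_coe.2 ((summable_nodeSum_bound 0).mul_right _)
    · rw [Real.norm_of_nonneg (NNReal.coe_nonneg _)]
      refine NNReal.coe_le_coe.2 ((nodeSum_term_le hA hY 0 j y).trans ?_)
      refine mul_le_mul' le_rfl (mul_le_mul' le_rfl (add_le_add le_rfl hy))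
  have heq : ((↑) : ℝ≥0 → ℝ) ∘ nodeSum A Y =
      fun y => ∑' j, ((A ^ (-j) * min y (Y j) : ℝ≥0) : ℝ) :=
    funext fun y => NNReal.coe_tsum
  rw [heq]
  exact hon.continuousAt (Iic_mem_nhds (lt_add_one x))

theorem nodeSum_tendsto_atTop (hA : 2 ≤ A) (hY0 : ∀ j, 0 < Y j)
    (hY : ∀ j, 2 * A * Y j ≤ Y (j + 1)) : Tendsto (nodeSum A Y) atTop atTop := by
  have hA0 : 0 < A := two_pos.trans_le hA
  refine tendsto_atTop_atTop_of_monotone (nodeSum_strictMono hA hY0 hY).monotone fun M => ?_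
  obtain ⟨k, hk⟩ := pow_unbounded_of_one_lt (M / Y 0) (one_lt_two (α := ℝ≥0))
  rw [div_lt_iff₀ (hY0 0)] at hk
  refine ⟨Y (0 + (k : ℤ)), hk.le.trans ?_⟩
  have hgrow := two_pow_mul_le (Y := fun j => A ^ (-j) * Y j) (fun j => ?_) 0 k
  · simp only [neg_zero, zpow_zero, one_mul] at hgrow
    refine hgrow.trans ?_
    simpa using le_nodeSum hA hY (0 + (k : ℤ)) (Y (0 + (k : ℤ)))
  · calc 2 * (A ^ (-j) * Y j) = A ^ (-(j + 1)) * (2 * A * Y j) := by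
          rw [neg_add, zpow_add₀ hA0.ne', zpow_neg_one]; field_simp
      _ ≤ _ := mul_le_mul' le_rfl (hY j)

/-- For nodes `Y j` growing faster than `(2A) ^ j` the concave function
`φ(y) = ∑ⱼ A ^ (-j) min(y, Y j)` and its companion `ψ(y) = y / φ(y)` are `φ`-functions, and `ψ`
maps the nodes `Y k` to the geometric progression `A ^ k`, up to constants. -/
theorem exists_factorization (hA : 2 ≤ A) (hY0 : ∀ j, 0 < Y j)
    (hY : ∀ j, 2 * A * Y j ≤ Y (j + 1)) :
    ∃ (φ ψ : PhiFunction) (S : ℝ≥0), (∀ t, φ t * ψ t = t) ∧ 0 < S ∧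
      ∀ k, ψ (Y k) ≤ A ^ k ∧ A ^ k ≤ S * ψ (Y k) := by
  have hA0 : 0 < A := two_pos.trans_le hA
  have hA1 : 1 < A := one_lt_two.trans_le hA
  have hAp : ∀ j : ℤ, 0 < A ^ j := fun j => zpow_pos hA0 j
  have hφpos : ∀ y, 0 < y → 0 < nodeSum A Y y := fun y hy => nodeSum_pos hA hY0 hY hy
  have hφ0 : nodeSum A Y 0 = 0 := by simp [nodeSum]
  set S₀ := ∑' j : ℤ, (2⁻¹ : ℝ≥0) ^ j.natAbs
  have hS₀pos : 0 < S₀ := by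
    have h1 : (2⁻¹ : ℝ≥0) ^ (0 : ℤ).natAbs ≤ S₀ :=
      summable_two_inv_pow_natAbs.le_tsum 0 fun _ _ => zero_le
    exact lt_of_lt_of_le (by simp) h1
  obtain ⟨ψ, hψ⟩ : ∃ ψ : ℝ≥0 → ℝ≥0, ∀ y, ψ y = y / nodeSum A Y y := ⟨_, fun _ => rfl⟩
  have hψ0 : ψ 0 = 0 := by simp [hψ]
  have hψmono : StrictMono ψ := by
    intro x y hxy
    have hy : 0 < y := lt_of_le_of_lt zero_le hxy
    rw [hψ, hψ]
    rcases eq_or_ne x 0 with rfl | hx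
    · rw [zero_div]; exact div_pos hy (hφpos y hy)
    · have hx0 := pos_iff_ne_zero.2 hx
      exact (div_lt_div_iff₀ (hφpos x hx0) (hφpos y hy)).2 (mul_nodeSum_lt hA hY0 hY hx0 hxy)
  have hψhi : ∀ k, ψ (Y k) ≤ A ^ k := by
    intro k
    rw [hψ, div_le_iff₀ (hφpos _ (hY0 k))]
    calc Y k = A ^ k * (A ^ (-k) * Y k) := by
          rw [← mul_assoc, zpow_neg, mul_inv_cancel₀ (hAp k).ne', one_mul]
      _ ≤ _ := mul_le_mul' le_rfl (by simpa using le_nodeSum hA hY k (Y k))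
  have hψlo : ∀ k, A ^ k ≤ 2 * S₀ * ψ (Y k) := by
    intro k
    rw [hψ, ← mul_div_assoc, le_div_iff₀ (hφpos _ (hY0 k))]
    calc A ^ k * nodeSum A Y (Y k) ≤ A ^ k * (S₀ * (A ^ (-k) * (Y k + Y k))) :=
          mul_le_mul' le_rfl (nodeSum_le hA hY k (Y k))
      _ = 2 * S₀ * Y k * (A ^ k * A ^ (-k)) := by ring
      _ = _ := by rw [zpow_neg, mul_inv_cancel₀ (hAp k).ne', mul_one]
  have hψtop : Tendsto ψ atTop atTop := by
    refine tendsto_atTop_atTop_of_monotone hψmono.monotone fun M => ?_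
    obtain ⟨k, hk⟩ := pow_unbounded_of_one_lt (2 * S₀ * M) hA1
    refine ⟨Y k, le_of_mul_le_mul_left (hk.le.trans ?_) (mul_pos two_pos hS₀pos)⟩
    rw [← zpow_natCast]
    exact hψlo k
  have hψcont : Continuous ψ := by
    rw [continuous_iff_continuousAt]
    intro x
    rcases eq_or_ne x 0 with rfl | hx
    · rw [ContinuousAt, hψ0, tendsto_order]
      refine ⟨fun e he => absurd he (not_lt.2 zero_le), fun e he => ?_⟩
      obtain ⟨k, hk⟩ := exists_pow_lt_of_lt_one he (inv_lt_one_of_one_lt₀ hA1)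
      filter_upwards [Iio_mem_nhds (hY0 (-k))] with y hy
      refine (hψmono hy).trans_le ((hψhi _).trans (le_trans (le_of_eq ?_) hk.le))
      rw [zpow_neg, zpow_natCast, inv_pow]
    · rw [funext hψ]
      exact continuousAt_id.div₀ (nodeSum_continuous hA hY).continuousAt
        (hφpos x (pos_iff_ne_zero.2 hx)).ne'
  refine ⟨⟨nodeSum A Y, hφ0, nodeSum_tendsto_atTop hA hY0 hY, nodeSum_strictMono hA hY0 hY,
    nodeSum_continuous hA hY⟩, ⟨ψ, hψ0, hψtop, hψmono, hψcont⟩, 2 * S₀, fun y => ?_,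
    mul_pos two_pos hS₀pos, fun k => ⟨hψhi k, hψlo k⟩⟩
  change nodeSum A Y y * ψ y = y
  rw [hψ]
  rcases eq_or_ne y 0 with rfl | hy
  · simp
  · exact mul_div_cancel₀ _ (hφpos y (pos_iff_ne_zero.2 hy)).ne'

/-- Since `ψ` takes the nodes to a geometric progression, the integral of condition (J) for the
inverse of `φ` is bounded by a sum of ratios of nodes a fixed number of steps apart; each further
step at least halves the sum. -/
theorem conditionJ_of_nodes {φ ψ : PhiFunction} {S : ℝ≥0} (hφψ : ∀ t, φ t * ψ t = t)
    (hS : 0 < S) (hA : 0 < A) (hY0 : ∀ j, 0 < Y j) (hY : ∀ j, 2 * Y j ≤ Y (j + 1))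
    (hψ : ∀ k, ψ (Y k) ≤ A ^ k ∧ A ^ k ≤ S * ψ (Y k))
    {r : ℕ} (hr : Summable fun j : ℤ => Y (j - r) / Y j) : φ.symm.ConditionJ := by
  obtain ⟨q, hq⟩ := pow_unbounded_of_one_lt (∑' j : ℤ, Y (j - r) / Y j) (one_lt_two (α := ℝ≥0))
  set p := r + q with hp
  set c : ℝ≥0 := S * A ^ ((p : ℤ) + 1) with hc
  have hc0 : 0 < c := mul_pos hS (zpow_pos hA _)
  refine ⟨ψ.symm, complementary_symm_symm_of_mul_eq hφψ, ?_⟩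
  refine lt_of_le_of_lt (iInf_le_of_le c (iInf_le_of_le hc0 (iInf_le_of_le ?_ le_rfl)))
    ENNReal.coe_lt_top
  have hcell : ∀ j : ℤ, ∫⁻ x in Ioc (Y (j + 1))⁻¹ (Y j)⁻¹,
      ψ.symm.extend (1 / (ψ.symm.tilde.symm x : ℝ≥0∞) / c) ∂lebesgueHalfLine ≤
        ((2⁻¹ ^ q * (Y (j - r) / Y j) : ℝ≥0) : ℝ≥0∞) := by
    intro j
    refine (setLIntegral_Ioc_le _ _ _ (Y (j - p) : ℝ≥0) fun x hx => ?_).trans ?_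
    · have hx0 : 0 < x := lt_of_le_of_lt zero_le hx.1
      have hψx : 0 < ψ x⁻¹ := ψ.pos (inv_pos.2 hx0)
      rw [tilde_symm_apply, symm_symm, one_div, ← ENNReal.coe_inv (inv_pos.2 hψx).ne', inv_inv,
        ← ENNReal.coe_div hc0.ne', extend_coe, ENNReal.coe_le_coe, symm_le_iff, div_le_iff₀ hc0]
      calc ψ x⁻¹ ≤ ψ (Y (j + 1)) := ψ.monotone (inv_le_of_inv_le₀ (hY0 _) hx.1.le)
        _ ≤ A ^ (j + 1) := (hψ _).1
        _ = A ^ (j - p) * A ^ ((p : ℤ) + 1) := by rw [← zpow_add₀ hA.ne']; congr 1; ring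
        _ ≤ S * ψ (Y (j - p)) * A ^ ((p : ℤ) + 1) := by gcongr; exact (hψ _).2
        _ = _ := by rw [hc]; ring
    · rw [← ENNReal.coe_mul, ENNReal.coe_le_coe]
      have h1 : Y (j - p) ≤ 2⁻¹ ^ q * Y (j - r) := by
        have h2 := two_pow_mul_le hY (j - p) q
        rw [show j - (p : ℤ) + q = j - r by rw [hp]; push_cast; ring] at h2
        rw [inv_pow, le_inv_mul_iff₀ (by positivity)]
        exact h2
      calc Y (j - p) * ((Y j)⁻¹ - (Y (j + 1))⁻¹) ≤ 2⁻¹ ^ q * Y (j - r) * (Y j)⁻¹ := by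
            gcongr
            exact tsub_le_self
        _ = _ := by rw [div_eq_mul_inv, mul_assoc]
  calc _ ≤ ∑' j : ℤ, ∫⁻ x in Ioc (Y (j + 1))⁻¹ (Y j)⁻¹,
      ψ.symm.extend (1 / (ψ.symm.tilde.symm x : ℝ≥0∞) / c) ∂lebesgueHalfLine := by
        refine lintegral_le_tsum_Ioc _ (fun j => (Y j)⁻¹) fun t ht => ?_
        obtain ⟨j, hj₁, hj₂⟩ := exists_node_le_lt hY0 hY (inv_pos.2 ht)
        exact ⟨j, inv_lt_of_inv_lt₀ ht hj₂, le_inv_of_le_inv₀ (hY0 j) hj₁⟩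
    _ ≤ ∑' j : ℤ, ((2⁻¹ ^ q * (Y (j - r) / Y j) : ℝ≥0) : ℝ≥0∞) := ENNReal.tsum_le_tsum hcell
    _ = ((2⁻¹ ^ q * ∑' j : ℤ, Y (j - r) / Y j : ℝ≥0) : ℝ≥0∞) := by
        rw [← ENNReal.coe_tsum (hr.mul_left _), NNReal.tsum_mul_left]
    _ ≤ 1 := by
        rw [ENNReal.coe_le_one_iff, inv_pow, inv_mul_le_iff₀ (by positivity), mul_one]
        exact hq.le

/-- A function increasing on either side of one exceptional step, across which it drops by a
bounded factor, is increasing up to a constant. -/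
theorem le_mul_of_le_succ {u : ℤ → ℝ≥0} {C : ℝ≥0} (hC : 1 ≤ C) (hu : ∀ j, j ≠ -1 → u j ≤ u (j + 1))
    (h0 : u (-1) ≤ C * u 0) {i j : ℤ} (hij : i ≤ j) : u i ≤ C * u j := by
  have hmono : Monotone fun j : ℤ => if j < 0 then u j else C * u j := by
    refine monotone_int_of_le_succ fun j => ?_
    rcases lt_trichotomy j (-1) with h | rfl | h
    · rw [if_pos (by omega), if_pos (by omega)]
      exact hu j h.ne
    · simpa using h0
    · rw [if_neg (by omega), if_neg (by omega)]
      gcongr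
      exact hu j h.ne'
  have hle : ∀ x : ℝ≥0, x ≤ C * x := fun x => le_mul_of_one_le_left zero_le hC
  have h := hmono hij
  simp only at h
  split_ifs at h
  · exact h.trans (hle _)
  · exact h
  · exact (hle _).trans (h.trans (hle _))
  · exact (hle _).trans h

/-- If the growth of `T` over a cell `[Y j, Y (j + 1)]` falls short of linear growth by at most the
factor `A`, then `T(y) / φ(y)` is increasing up to a constant, because `y / φ(y)` grows by the factor
`A` over each cell. The cell of index `-1` is exempt. -/
theorem exists_nFunction_of_nodes {T : PhiFunction} {C : ℝ≥0} (hA : 2 ≤ A) (hC : 1 ≤ C)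
    (hY0 : ∀ j, 0 < Y j) (hY : ∀ j, 2 * A * Y j ≤ Y (j + 1))
    {r : ℕ} (hr : Summable fun j : ℤ => Y (j - r) / Y j)
    (hT : ∀ j, j ≠ -1 → T (Y j) * Y (j + 1) ≤ A * (T (Y (j + 1)) * Y j))
    (hTC : ∀ j x y, Y j ≤ x → x ≤ y → y ≤ Y (j + 1) → T x * y ≤ C * (T y * x)) :
    ∃ H : PhiFunction, H.IsNFunction ∧ H.ConditionJ ∧ T.EquivalentlyMoreConvex H.symm := by
  have hA0 : 0 < A := two_pos.trans_le hA
  have hA1 : 1 ≤ A := one_le_two.trans hA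
  have hY2 : ∀ j, 2 * Y j ≤ Y (j + 1) := fun j =>
    le_trans (by gcongr; exact le_mul_of_one_le_right zero_le hA1) (hY j)
  obtain ⟨φ, ψ, S, hφψ, hS, hψ⟩ := exists_factorization hA hY0 hY
  refine ⟨φ.symm, isNFunction_symm_of_mul_eq hφψ,
    conditionJ_of_nodes hφψ hS hA0 hY0 hY2 hψ hr, ?_⟩
  have hstrict := strictMono_nodes hY0 hY2
  have hnode : ∀ {i j : ℤ}, i ≤ j →
      T (Y i) / Y i * A ^ i ≤ C * (T (Y j) / Y j * A ^ j) := by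
    intro i j hij
    refine le_mul_of_le_succ (u := fun j => T (Y j) / Y j * A ^ j) hC (fun j hj => ?_) ?_ hij
    · rw [zpow_add_one₀ hA0.ne']
      have h := hT j hj
      have h1 : T (Y j) / Y j ≤ A * (T (Y (j + 1)) / Y (j + 1)) := by
        rw [div_le_iff₀ (hY0 _), show A * (T (Y (j + 1)) / Y (j + 1)) * Y j =
          A * (T (Y (j + 1)) * Y j) / Y (j + 1) by ring, le_div_iff₀ (hY0 _)]
        exact h
      calc T (Y j) / Y j * A ^ j ≤ A * (T (Y (j + 1)) / Y (j + 1)) * A ^ j := by gcongr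
        _ = _ := by ring
    · have h := hTC (-1) (Y (-1)) (Y 0) le_rfl (hstrict.monotone (by norm_num)) le_rfl
      have h1 : T (Y (-1)) / Y (-1) ≤ C * (T (Y 0) / Y 0) := by
        rw [div_le_iff₀ (hY0 _), show C * (T (Y 0) / Y 0) * Y (-1) =
          C * (T (Y 0) * Y (-1)) / Y 0 by ring, le_div_iff₀ (hY0 _)]
        exact h
      calc T (Y (-1)) / Y (-1) * A ^ (-1 : ℤ) ≤ C * (T (Y 0) / Y 0) * 1 := by
            gcongr
            exact zpow_le_one_of_nonpos₀ hA1 (by norm_num)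
        _ = _ := by simp
  have hratio : ∀ {i j : ℤ} {x y : ℝ≥0}, Y i ≤ x → x ≤ Y (i + 1) → Y j ≤ y → y ≤ Y (j + 1) →
      x ≤ y → i ≤ j → T x / x * A ^ i ≤ C ^ 3 * (T y / y * A ^ j) := by
    intro i j x y hix hxi hjy hyj hxy hij
    have hcell : ∀ k x y, Y k ≤ x → x ≤ y → y ≤ Y (k + 1) → T x / x ≤ C * (T y / y) := by
      intro k x y h1 h2 h3
      have hx0 : 0 < x := (hY0 k).trans_le h1
      rw [div_le_iff₀ hx0, show C * (T y / y) * x = C * (T y * x) / y by ring,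
        le_div_iff₀ (hx0.trans_le h2)]
      exact hTC k x y h1 h2 h3
    rcases hij.eq_or_lt with rfl | hlt
    · calc T x / x * A ^ i ≤ C * (T y / y) * A ^ i := by
            gcongr
            exact hcell i x y hix hxy hyj
        _ ≤ C ^ 3 * (T y / y) * A ^ i := by
            gcongr
            exact le_self_pow₀ hC (by norm_num)
        _ = _ := by ring
    · calc T x / x * A ^ i ≤ C * (T (Y (i + 1)) / Y (i + 1)) * A ^ (i + 1) := by
            gcongr
            · exact hcell i x _ hix hxi le_rfl
            · omega
        _ = C * (T (Y (i + 1)) / Y (i + 1) * A ^ (i + 1)) := by ring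
        _ ≤ C * (C * (T (Y j) / Y j * A ^ j)) := mul_le_mul' le_rfl (hnode (by omega))
        _ ≤ C * (C * (C * (T y / y) * A ^ j)) := by
            gcongr
            exact hcell j _ y le_rfl hjy hyj
        _ = _ := by ring
  have hmain : ∀ x y, x ≤ y → T x * φ y ≤ C ^ 3 * S * A * (T y * φ x) := by
    intro x y hxy
    rcases eq_or_ne x 0 with rfl | hx
    · simp [map_zero]
    have hx0 := pos_iff_ne_zero.2 hx
    have hy0 := hx0.trans_le hxy
    obtain ⟨i, hi₁, hi₂⟩ := exists_node_le_lt hY0 hY2 hx0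
    obtain ⟨j, hj₁, hj₂⟩ := exists_node_le_lt hY0 hY2 hy0
    have hij : i ≤ j := by
      have := hstrict.lt_iff_lt.1 (lt_of_le_of_lt hi₁ (lt_of_le_of_lt hxy hj₂))
      omega
    have h1 := hratio hi₁ hi₂.le hj₁ hj₂.le hxy hij
    have h2 : ψ x ≤ A ^ i * A := by
      rw [← zpow_add_one₀ hA0.ne']
      exact (ψ.monotone hi₂.le).trans (hψ _).1
    have h3 : A ^ j ≤ S * ψ y := (hψ j).2.trans (by gcongr; exact ψ.monotone hj₁)
    have hφy := φ.pos hy0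
    have hψy := ψ.pos hy0
    have hφx := φ.pos hx0
    have e1 : T x / x * ψ x = T x / φ x := by
      nth_rewrite 2 [← hφψ x]
      have := (ψ.pos hx0).ne'
      field_simp
    have e2 : T y / y * ψ y = T y / φ y := by
      nth_rewrite 2 [← hφψ y]
      field_simp
    have h4 : T x / φ x ≤ C ^ 3 * S * A * (T y / φ y) := by
      calc T x / φ x = T x / x * ψ x := e1.symm
        _ ≤ T x / x * (A ^ i * A) := by gcongr
        _ = T x / x * A ^ i * A := by ring
        _ ≤ C ^ 3 * (T y / y * A ^ j) * A := by gcongr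
        _ ≤ C ^ 3 * (T y / y * (S * ψ y)) * A := by gcongr
        _ = C ^ 3 * S * A * (T y / y * ψ y) := by ring
        _ = _ := by rw [e2]
    rw [div_le_iff₀ hφx, show C ^ 3 * S * A * (T y / φ y) * φ x =
      C ^ 3 * S * A * (T y * φ x) / φ y by ring, le_div_iff₀ hφy] at h4
    exact h4
  obtain ⟨V, hV, hequiv⟩ := exists_convexOn_equivalent (M := T.comp φ.symm)
    (C := C ^ 3 * S * A) (fun s t hst => by
      have := hmain _ _ (φ.symm.monotone hst)
      simpa only [apply_symm, comp_apply] using this)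
  refine ⟨V, hV, ?_⟩
  rwa [symm_symm]

end NodeSum

end PhiFunction

/-! ### Division of the grid into cells -/

/-- Greedy division: every cell contains a bad interval, but no bad interval starting in the cell
ends before its right endpoint. -/
theorem exists_greedy_seq {Bad : ℤ → ℤ → Prop} (hlt : ∀ x y, Bad x y → x < y)
    (hex : ∀ k, ∃ y, Bad k y) (R : ℤ) :
    ∃ f : ℕ → ℤ, f 0 = R ∧ ∀ i, (∃ x y, f i ≤ x ∧ y ≤ f (i + 1) ∧ Bad x y) ∧
      ∀ x y, f i ≤ x → y < f (i + 1) → ¬ Bad x y := by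
  have hnext : ∀ k : ℤ, ∃ k', (∃ x y, k ≤ x ∧ y ≤ k' ∧ Bad x y) ∧
      ∀ x y, k ≤ x → y < k' → ¬ Bad x y := by
    intro k
    obtain ⟨y, hy⟩ := hex k
    obtain ⟨k', ⟨x', hx', hb'⟩, hmin⟩ := Int.exists_least_of_bdd
      (P := fun y => ∃ x, k ≤ x ∧ Bad x y)
      ⟨k, fun z ⟨x, hx, hb⟩ => hx.trans (hlt x z hb).le⟩ ⟨y, k, le_rfl, hy⟩
    refine ⟨k', ⟨x', k', hx', le_rfl, hb'⟩, fun x y hx hyk hb => ?_⟩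
    exact absurd (hmin y ⟨x, hx, hb⟩) (not_le.2 hyk)
  choose next hnext using hnext
  refine ⟨fun n => next^[n] R, rfl, fun i => ?_⟩
  simp only [Function.iterate_succ_apply']
  exact hnext _

/-- Greedy division in both directions from a central cell, taken so large that it contains the
left endpoints of all bad intervals of length at most `D`. -/
theorem exists_greedy_division {Bad : ℤ → ℤ → Prop} (hlt : ∀ x y, Bad x y → x < y)
    (hright : ∀ k, ∃ y, Bad k y) (hleft : ∀ k, ∃ x, Bad x k)
    (hfin : ∀ m : ℕ, 1 ≤ m → {x | Bad x (x + m)}.Finite) (D : ℕ) :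
    ∃ κ : ℤ → ℤ, (∀ j, κ j + D < κ (j + 1)) ∧
      (∀ j, j ≠ -1 → ∃ x y, κ j ≤ x ∧ y ≤ κ (j + 1) ∧ Bad x y) ∧
      ∀ j, j ≠ -1 → ∀ x y, κ j < x → y < κ (j + 1) → ¬ Bad x y := by
  have hshort : (⋃ m ∈ Finset.Icc 1 D, {x | Bad x (x + m)}).Finite :=
    (Finset.Icc 1 D).finite_toSet.biUnion fun m hm => hfin m (Finset.mem_Icc.1 hm).1
  obtain ⟨M, hM⟩ := hshort.bddAbove
  obtain ⟨L, hL⟩ := hshort.bddBelow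
  set R : ℤ := max (max (M + 1) (1 - L)) (D + 1) with hR
  have hlong : ∀ x y, Bad x y → R ≤ x ∨ x ≤ -R → (D : ℤ) < y - x := by
    intro x y hb hx
    by_contra! hle
    have hxy := hlt x y hb
    have hmem : x ∈ ⋃ m ∈ Finset.Icc 1 D, {x | Bad x (x + m)} := by
      refine mem_biUnion (x := (y - x).toNat) (Finset.mem_coe.2 (Finset.mem_Icc.2 (by omega))) ?_
      rw [mem_ofPred_eq, show x + ((y - x).toNat : ℤ) = y by omega]
      exact hb
    have h1 := hM hmem
    have h2 := hL hmem
    omega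
  obtain ⟨f, hf0, hf⟩ := exists_greedy_seq hlt hright R
  obtain ⟨g, hg0, hg⟩ := exists_greedy_seq (Bad := fun x y => Bad (-y) (-x))
    (fun x y h => by have := hlt _ _ h; omega)
    (fun k => by obtain ⟨x, hx⟩ := hleft (-k); exact ⟨-x, by simpa using hx⟩) R
  have hfR : ∀ i, R ≤ f i ∧ f i + D < f (i + 1) := by
    intro i
    have hi : R ≤ f i := by
      induction i with
      | zero => exact hf0.ge
      | succ i ih =>
        obtain ⟨⟨x, y, hx, hy, hb⟩, -⟩ := hf i
        have := hlt x y hb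
        omega
    obtain ⟨⟨x, y, hx, hy, hb⟩, -⟩ := hf i
    have := hlong x y hb (Or.inl (hi.trans hx))
    omega
  have hgR : ∀ i, R ≤ g i ∧ g i + D < g (i + 1) := by
    intro i
    have hi : R ≤ g i := by
      induction i with
      | zero => exact hg0.ge
      | succ i ih =>
        obtain ⟨⟨x, y, hx, hy, hb⟩, -⟩ := hg i
        have := hlt _ _ hb
        omega
    obtain ⟨⟨x, y, hx, hy, hb⟩, -⟩ := hg i
    have := hlong _ _ hb (Or.inr (by have := hlt _ _ hb; omega))
    omega
  set κ : ℤ → ℤ := fun j => if 0 ≤ j then f j.toNat else -g (-j - 1).toNat with hκ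
  have hκpos : ∀ i : ℕ, κ i = f i := fun i => by simp [hκ]
  have hκneg : ∀ i : ℕ, κ (-(i : ℤ) - 1) = -g i := fun i => by
    simp only [hκ]
    rw [if_neg (by omega), show (-(-(i : ℤ) - 1) - 1).toNat = i by omega]
  have hcases : ∀ j : ℤ, (∃ i : ℕ, κ j = f i ∧ κ (j + 1) = f (i + 1)) ∨
      (∃ i : ℕ, κ j = -g (i + 1) ∧ κ (j + 1) = -g i) ∨ j = -1 := by
    intro j
    rcases lt_trichotomy j (-1) with h | h | h
    · obtain ⟨i, rfl⟩ : ∃ i : ℕ, j = -((i + 1 : ℕ) : ℤ) - 1 := ⟨(-j - 2).toNat, by omega⟩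
      refine Or.inr (Or.inl ⟨i, hκneg _, ?_⟩)
      rw [← hκneg i]
      congr 1
      push_cast
      ring
    · exact Or.inr (Or.inr h)
    · obtain ⟨i, rfl⟩ : ∃ i : ℕ, j = i := ⟨j.toNat, by omega⟩
      exact Or.inl ⟨i, hκpos _, by rw [← hκpos]; push_cast; rfl⟩
  have hmid : κ (-1) + D < κ 0 := by
    have e1 : κ (-1) = -R := by have := hκneg 0; rw [hg0] at this; simpa using this
    have e2 : κ 0 = R := by have := hκpos 0; rw [hf0] at this; simpa using this
    omega
  refine ⟨κ, fun j => ?_, fun j hj => ?_, fun j hj x y hx hy hb => ?_⟩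
  · rcases hcases j with ⟨i, e1, e2⟩ | ⟨i, e1, e2⟩ | rfl
    · have := (hfR i).2; omega
    · have := (hgR i).2; omega
    · simpa using hmid
  · rcases hcases j with ⟨i, e1, e2⟩ | ⟨i, e1, e2⟩ | rfl
    · rw [e1, e2]; exact (hf i).1
    · obtain ⟨⟨x, y, hx, hy, hb⟩, -⟩ := hg i
      exact ⟨-y, -x, by omega, by omega, hb⟩
    · exact absurd rfl hj
  · rcases hcases j with ⟨i, e1, e2⟩ | ⟨i, e1, e2⟩ | rfl
    · exact (hf i).2 x y (by omega) (by omega) hb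
    · exact (hg i).2 (-y) (-x) (by omega) (by omega) (by simpa using hb)
    · exact absurd rfl hj

/-- If there are fewer than `b ^ m` bad intervals of length `m`, then the lengths of the cells of a
greedy division are large on average: disjoint cells contain distinct bad intervals. -/
theorem summable_inv_pow_cell_length {Bad : ℤ → ℤ → Prop} (hlt : ∀ x y, Bad x y → x < y)
    {b c : ℝ≥0} (hbc : b < c) (hc : 1 ≤ c)
    (hfin : ∀ m : ℕ, 1 ≤ m → {x | Bad x (x + m)}.Finite ∧
      ({x | Bad x (x + m)}.ncard : ℝ≥0) ≤ b ^ m)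
    {κ : ℤ → ℤ} (hκ : StrictMono κ)
    (hbad : ∀ j, j ≠ -1 → ∃ x y, κ j ≤ x ∧ y ≤ κ (j + 1) ∧ Bad x y) :
    Summable fun j => (c ^ (κ (j + 1) - κ j))⁻¹ := by
  classical
  have hc0 : 0 < c := one_pos.trans_le hc
  set w : ℕ × ℤ → ℝ≥0 := fun p => if Bad p.2 (p.2 + p.1) then (c ^ p.1)⁻¹ else 0 with hw
  have hwsum : ∑' p, (w p : ℝ≥0∞) ≠ ∞ := by
    have hinner : ∀ m : ℕ, ∑' x : ℤ, (w (m, x) : ℝ≥0∞) ≤ (((b / c) ^ m : ℝ≥0) : ℝ≥0∞) := by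
      intro m
      rcases Nat.eq_zero_or_pos m with rfl | hm
      · have h0 : ∀ x : ℤ, w (0, x) = 0 := fun x => by
          have : ¬ Bad x (x + ((0 : ℕ) : ℤ)) := fun h => by have := hlt _ _ h; omega
          simp only [hw, if_neg this]
        simp [h0]
      · obtain ⟨hf, hcard⟩ := hfin m hm
        rw [tsum_eq_sum (s := hf.toFinset) (fun x hx => by
          have : ¬ Bad x (x + m) := by simpa using hx
          simp only [hw, if_neg this, ENNReal.coe_zero])]
        rw [← ENNReal.ofNNReal_finsetSum, ENNReal.coe_le_coe]
        calc ∑ x ∈ hf.toFinset, w (m, x) ≤ ∑ _x ∈ hf.toFinset, (c ^ m)⁻¹ := by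
              refine Finset.sum_le_sum fun x _ => ?_
              simp only [hw]
              split_ifs
              · exact le_rfl
              · exact zero_le
          _ = {x | Bad x (x + m)}.ncard * (c ^ m)⁻¹ := by
              rw [Finset.sum_const, nsmul_eq_mul, Set.ncard_eq_toFinset_card _ hf]
          _ ≤ b ^ m * (c ^ m)⁻¹ := by gcongr
          _ = _ := by rw [div_pow, div_eq_mul_inv]
    rw [ENNReal.tsum_prod']
    refine ne_top_of_le_ne_top ?_ (ENNReal.tsum_le_tsum hinner)
    rw [ENNReal.tsum_coe_ne_top_iff_summable]
    exact NNReal.summable_geometric ((div_lt_one hc0).2 hbc)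
  have hws : Summable w := ENNReal.tsum_coe_ne_top_iff_summable.1 hwsum
  have hbad' : ∀ j : {j : ℤ // j ∉ ({-1} : Finset ℤ)}, ∃ (m : ℕ) (x : ℤ), κ j ≤ x ∧
      x + m ≤ κ (j + 1) ∧ 1 ≤ m ∧ Bad x (x + m) := by
    rintro ⟨j, hj⟩
    obtain ⟨x, y, hx, hy, hb⟩ := hbad j (by simpa using hj)
    have := hlt x y hb
    have e : x + ((y - x).toNat : ℤ) = y := by omega
    exact ⟨(y - x).toNat, x, hx, by rw [e]; exact hy, by omega, by rw [e]; exact hb⟩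
  choose m x hx hmx hm hb using hbad'
  have hinj : Function.Injective fun j => (m j, x j) := by
    intro i j hij
    simp only [Prod.mk.injEq] at hij
    have h1 : κ i < κ (j + 1) := by have := hx i; have := hmx j; have := hm j; omega
    have h2 : κ j < κ (i + 1) := by have := hx j; have := hmx i; have := hm i; omega
    have h3 := hκ.lt_iff_lt.1 h1
    have h4 := hκ.lt_iff_lt.1 h2
    exact Subtype.ext (by omega)
  rw [← NNReal.summable_coe]
  refine (Finset.summable_compl_iff (f := fun j => (((c ^ (κ (j + 1) - κ j))⁻¹ : ℝ≥0) : ℝ))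
    {(-1 : ℤ)}).1 (NNReal.summable_coe.2 ?_)
  refine NNReal.summable_of_le (fun j => ?_) (NNReal.summable_comp_injective hws hinj)
  simp only [hw, Function.comp_apply, if_pos (hb j)]
  rw [← zpow_natCast]
  refine inv_anti₀ (zpow_pos hc0 _) (zpow_le_zpow_right₀ hc ?_)
  have := hx j
  have := hmx j
  omega

/-- A product of `r` numbers is at most the sum of their `r`-th powers. -/
theorem summable_ratio_of_summable_pow {Y : ℤ → ℝ≥0} (hY0 : ∀ j, 0 < Y j) {r : ℕ} (hr : 1 ≤ r)
    (h : Summable fun j => (Y j / Y (j + 1)) ^ r) : Summable fun j : ℤ => Y (j - r) / Y j := by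
  have hprod : ∀ (j : ℤ) (n : ℕ), Y (j - n) / Y j =
      ∏ i ∈ Finset.range n, Y (j - (i + 1 : ℕ)) / Y (j - (i + 1 : ℕ) + 1) := by
    intro j n
    induction n with
    | zero => simp [div_self (hY0 j).ne']
    | succ n ih =>
      rw [Finset.prod_range_succ, ← ih,
        show j - ((n + 1 : ℕ) : ℤ) + 1 = j - n by push_cast; ring]
      have := (hY0 j).ne'
      have := (hY0 (j - n)).ne'
      field_simp
  refine NNReal.summable_of_le (g := fun j : ℤ => Y (j - r) / Y j)
    (f := fun j : ℤ => ∑ i ∈ Finset.range r,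
      (Y (j - (i + 1 : ℕ)) / Y (j - (i + 1 : ℕ) + 1)) ^ r) (fun j => ?_) ?_
  · rw [hprod]
    obtain ⟨i₀, hi₀, hmax⟩ := Finset.exists_max_image (Finset.range r)
      (fun i : ℕ => Y (j - (i + 1 : ℕ)) / Y (j - (i + 1 : ℕ) + 1)) ⟨0, Finset.mem_range.2 hr⟩
    refine (Finset.prod_le_pow_card _ _ _ hmax).trans ?_
    rw [Finset.card_range]
    exact Finset.single_le_sum (f := fun i : ℕ =>
      (Y (j - (i + 1 : ℕ)) / Y (j - (i + 1 : ℕ) + 1)) ^ r) (fun _ _ => zero_le) hi₀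
  · refine summable_sum fun i _ => ?_
    exact NNReal.summable_comp_injective (i := fun j : ℤ => j - (i + 1 : ℕ)) h
      fun _ _ h => by simpa using h

namespace PhiFunction

/-- On a stretch of the grid without violating pairs the function `T` grows linearly up to a
constant. -/
theorem mul_le_of_forall_zpow {T : PhiFunction} {a : ℝ≥0} (ha : 1 < a) {N : ℕ} {k l : ℤ}
    (h : ∀ p q : ℤ, k < p → p < q → q < l → a ^ (q - p - (N : ℤ)) * T (a ^ p) ≤ T (a ^ q))
    {x y : ℝ≥0} (hx : a ^ k ≤ x) (hxy : x ≤ y) (hy : y ≤ a ^ l) :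
    T x * y ≤ a ^ (N + 4) * (T y * x) := by
  have ha0 : 0 < a := one_pos.trans ha
  have hx0 : 0 < x := (zpow_pos ha0 k).trans_le hx
  have hmono : StrictMono fun n : ℤ => a ^ n := zpow_right_strictMono₀ ha
  obtain ⟨i, hi₁, hi₂⟩ := exists_mem_Ioc_zpow hx0 ha
  obtain ⟨q, hq₁, hq₂⟩ := exists_mem_Ico_zpow (hx0.trans_le hxy) ha
  have hil : i < l := hmono.lt_iff_lt.1 (hi₁.trans_le (hxy.trans hy))
  have hkq : k < q + 1 := hmono.lt_iff_lt.1 ((hx.trans hxy).trans_lt hq₂)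
  set p' := max (i + 1) (k + 1) with hp'
  set q' := min q (l - 1) with hq'
  have hki : k ≤ i + 1 := hmono.le_iff_le.1 (hx.trans hi₂)
  have hql : q ≤ l := hmono.le_iff_le.1 (hq₁.trans hy)
  have hxp : x ≤ a ^ p' := hi₂.trans (zpow_le_zpow_right₀ ha.le (by omega))
  have hqy : a ^ q' ≤ y := le_trans (zpow_le_zpow_right₀ ha.le (by omega)) hq₁
  have hyx : y ≤ a ^ (q' - p' + 4) * x := by
    calc y ≤ a ^ (q + 1) := hq₂.le
      _ ≤ a ^ (q' - p' + 4 + i) := zpow_le_zpow_right₀ ha.le (by omega)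
      _ = a ^ (q' - p' + 4) * a ^ i := zpow_add₀ ha0.ne' _ _
      _ ≤ _ := mul_le_mul' le_rfl hi₁.le
  rcases lt_or_ge p' q' with hlt | hge
  · have h1 : a ^ (q' - p' - (N : ℤ)) * T x ≤ T y :=
      (mul_le_mul' le_rfl (T.monotone hxp)).trans
        ((h p' q' (by omega) hlt (by omega)).trans (T.monotone hqy))
    calc T x * y ≤ T x * (a ^ (q' - p' + 4) * x) := by gcongr
      _ = a ^ (N + 4) * (a ^ (q' - p' - (N : ℤ)) * T x * x) := by
        rw [show q' - p' + 4 = ((N + 4 : ℕ) : ℤ) + (q' - p' - (N : ℤ)) by push_cast; ring,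
          zpow_add₀ ha0.ne', zpow_natCast]
        ring
      _ ≤ _ := by gcongr
  · calc T x * y ≤ T y * (a ^ (q' - p' + 4) * x) := by
          gcongr
          exact T.monotone hxy
      _ ≤ T y * (a ^ (((N + 4 : ℕ) : ℤ)) * x) := by
          gcongr
          · exact ha.le
          · omega
      _ = _ := by rw [zpow_natCast]; ring

/-- The nodes are the powers `a ^ κ j` at the ends of the cells of a greedy division of `ℤ` with
respect to the intervals `[n, n + m]` which violate almost convexity. -/
theorem AlmostConvex.exists_nFunction {T : PhiFunction} (hT : T.AlmostConvex) :
    ∃ H : PhiFunction, H.IsNFunction ∧ H.ConditionJ ∧ T.EquivalentlyMoreConvex H.symm := by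
  obtain ⟨a, b, N, ha, hb, hN, hviol⟩ := hT
  lift b to ℝ≥0 using one_pos.le.trans hb.le
  have hb1 : (1 : ℝ≥0) < b := by exact_mod_cast hb
  have ha0 : 0 < a := one_pos.trans ha
  set viol : ℕ → Set ℤ := fun m => {n : ℤ | ¬ (a ^ ((m : ℤ) - (N : ℤ)) * T (a ^ n) ≤
    T (a ^ (n + (m : ℤ))))} with hviol_def
  -- The intervals `[x, y]` with `|x| < 2 ^ (y - x)` are added so that bad intervals occur
  -- arbitrarily far out, even for a convex `T`.
  set Bad : ℤ → ℤ → Prop := fun x y => x < y ∧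
    (x ∈ viol (y - x).toNat ∨ |x| < 2 ^ (y - x).toNat) with hBad
  have hlt : ∀ x y, Bad x y → x < y := fun x y h => h.1
  have hBadm : ∀ m : ℕ, 1 ≤ m → {x | Bad x (x + m)} ⊆ viol m ∪ Ioo (-2 ^ m : ℤ) (2 ^ m) := by
    intro m hm x hx
    obtain ⟨-, h⟩ := hx
    rw [show (x + (m : ℤ) - x).toNat = m by omega] at h
    exact h.imp id fun h => abs_lt.1 h
  have hfin : ∀ m : ℕ, 1 ≤ m → {x | Bad x (x + m)}.Finite ∧
      ({x | Bad x (x + m)}.ncard : ℝ≥0) ≤ (8 * b) ^ m := by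
    intro m hm
    obtain ⟨hvf, hvc⟩ := hviol m hm
    have hf : (viol m ∪ Ioo (-2 ^ m : ℤ) (2 ^ m)).Finite := hvf.union (finite_Ioo _ _)
    refine ⟨hf.subset (hBadm m hm), ?_⟩
    have hIoo : (Ioo (-2 ^ m : ℤ) (2 ^ m)).ncard ≤ 4 ^ m := by
      rw [← Finset.coe_Ioo, ncard_coe_finset, Int.card_Ioo]
      have h1 : (2 : ℤ) ^ m * 2 ≤ 4 ^ m := by
        rw [show (4 : ℤ) = 2 * 2 by norm_num, mul_pow]
        exact mul_le_mul_of_nonneg_left (le_self_pow₀ (by norm_num) (by omega)) (by positivity)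
      have h2 : (0 : ℤ) < 2 ^ m := by positivity
      zify
      omega
    have hvc' : ((viol m).ncard : ℝ≥0) ≤ b ^ m := by
      rw [← NNReal.coe_le_coe]
      push_cast
      exact hvc.le
    have hcard := (ncard_le_ncard (hBadm m hm) hf).trans (ncard_union_le _ _)
    calc ({x | Bad x (x + m)}.ncard : ℝ≥0) ≤ ((viol m).ncard + 4 ^ m : ℕ) := by
          exact_mod_cast hcard.trans (by gcongr)
      _ ≤ (4 * b) ^ m + (4 * b) ^ m := by
          push_cast
          gcongr
          · exact hvc'.trans (by gcongr; exact le_mul_of_one_le_left zero_le (by norm_num))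
          · exact le_mul_of_one_le_right zero_le hb1.le
      _ = 2 * (4 * b) ^ m := by ring
      _ ≤ 2 ^ m * (4 * b) ^ m := by
          gcongr
          exact le_self_pow₀ one_le_two (by omega)
      _ = _ := by rw [← mul_pow]; ring_nf
  have hbig : ∀ k : ℤ, ∃ m : ℕ, 1 ≤ m ∧ |k| + m < 2 ^ m := by
    intro k
    refine ⟨2 * k.natAbs + 3, by omega, ?_⟩
    have h1 : k.natAbs + 1 < 2 ^ (k.natAbs + 1) := Nat.lt_two_pow_self
    have h2 : 2 ^ (2 * k.natAbs + 3) = 2 * (2 ^ (k.natAbs + 1) * 2 ^ (k.natAbs + 1)) := by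
      rw [← pow_add, ← pow_succ']; congr 1; omega
    have h3 : k.natAbs + (2 * k.natAbs + 3) < 2 ^ (2 * k.natAbs + 3) := by
      rw [h2]; nlinarith
    rw [Int.abs_eq_natAbs]
    exact_mod_cast h3
  have hright : ∀ k, ∃ y, Bad k y := by
    intro k
    obtain ⟨m, hm, hkm⟩ := hbig k
    refine ⟨k + m, by omega, Or.inr ?_⟩
    rw [show (k + (m : ℤ) - k).toNat = m by omega]
    omega
  have hleft : ∀ k, ∃ x, Bad x k := by
    intro k
    obtain ⟨m, hm, hkm⟩ := hbig k
    refine ⟨k - m, by omega, Or.inr ?_⟩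
    rw [show (k - (k - (m : ℤ))).toNat = m by omega]
    refine lt_of_le_of_lt ?_ hkm
    have := abs_sub k (m : ℤ)
    rwa [Nat.abs_cast] at this
  obtain ⟨p, hp⟩ := pow_unbounded_of_one_lt 2 ha
  set s := max p (N + 4)
  have h2A : 2 ≤ a ^ s := hp.le.trans (pow_le_pow_right₀ ha.le (le_max_left _ _))
  have hNA : a ^ (N + 4) ≤ a ^ s := pow_le_pow_right₀ ha.le (le_max_right _ _)
  obtain ⟨κ, hκD, hκbad, hκgood⟩ := exists_greedy_division hlt hright hleft
    (fun m hm => (hfin m hm).1) (2 * s)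
  have hκ : StrictMono κ := strictMono_int_of_lt_succ fun j => by have := hκD j; omega
  set Y : ℤ → ℝ≥0 := fun j => a ^ κ j with hY_def
  have hY0 : ∀ j, 0 < Y j := fun j => zpow_pos ha0 _
  have hY : ∀ j, 2 * a ^ s * Y j ≤ Y (j + 1) := by
    intro j
    calc 2 * a ^ s * Y j ≤ a ^ s * a ^ s * Y j := by gcongr
      _ = a ^ (κ j + ((2 * s : ℕ) : ℤ)) := by
        rw [zpow_add₀ ha0.ne', zpow_natCast]; ring
      _ ≤ _ := zpow_le_zpow_right₀ ha.le (hκD j).le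
  obtain ⟨r, hr⟩ := pow_unbounded_of_one_lt (8 * b) ha
  have hr1 : 1 ≤ r := by
    by_contra! h0
    rw [Nat.lt_one_iff.1 h0, pow_zero] at hr
    have : (1 : ℝ≥0) ≤ 8 * b := one_le_mul_of_one_le_of_one_le (by norm_num) hb1.le
    exact absurd hr (not_lt.2 this)
  have hsum : Summable fun j => (Y j / Y (j + 1)) ^ r := by
    refine (summable_inv_pow_cell_length hlt hr (one_le_pow₀ ha.le) hfin hκ hκbad).congr
      fun j => ?_
    rw [hY_def, ← zpow_sub₀ ha0.ne', ← zpow_natCast a r, ← zpow_mul, ← zpow_natCast, ← zpow_mul,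
      ← zpow_neg]
    congr 1
    ring
  have hcell : ∀ j, j ≠ -1 → ∀ x y, Y j ≤ x → x ≤ y → y ≤ Y (j + 1) →
      T x * y ≤ a ^ s * (T y * x) := by
    intro j hj x y h1 h2 h3
    refine (mul_le_of_forall_zpow (N := N) ha (fun u v hu huv hv => ?_)
      h1 h2 h3).trans (by gcongr)
    by_contra hbad
    refine hκgood j hj u v hu hv ⟨huv, Or.inl ?_⟩
    rw [hviol_def, mem_ofPred_eq, show ((v - u).toNat : ℤ) = v - u by omega, add_sub_cancel]
    exact hbad
  refine exists_nFunction_of_nodes (A := a ^ s) (C := a ^ s + Y 0 / Y (-1)) h2A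
    ((one_le_pow₀ ha.le).trans le_self_add) hY0 hY (summable_ratio_of_summable_pow hY0 hr1 hsum)
    (fun j hj => hcell j hj _ _ le_rfl (hκ.monotone (by omega) |> zpow_le_zpow_right₀ ha.le) le_rfl)
    fun j x y h1 h2 h3 => ?_
  by_cases hj : j = -1
  · subst hj
    have hx0 := (hY0 (-1)).trans_le h1
    calc T x * y ≤ T y * (Y 0 / Y (-1) * x) := by
          refine mul_le_mul' (T.monotone h2) (h3.trans ?_)
          rw [show (-1 : ℤ) + 1 = 0 by norm_num]
          calc Y 0 = Y 0 / Y (-1) * Y (-1) := (div_mul_cancel₀ _ (hY0 _).ne').symm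
            _ ≤ _ := by gcongr
      _ = Y 0 / Y (-1) * (T y * x) := by ring
      _ ≤ _ := by gcongr; exact le_add_self
  · exact (hcell j hj x y h1 h2 h3).trans (by gcongr; exact le_self_add)

end PhiFunction

theorem theorem4p2 (F G₁ G₂ : PhiFunction) :
    ((G₁.Dilatory ∨ G₂.Dilatory) →
      (G₁.comp G₂.symm).AlmostConvex →
        ∃ c : ℝ≥0, ∀ f : ℝ≥0 → ℂ, Measurable f →
          orliczLorentz lebesgueHalfLine F G₁ f ≤ c * orliczLorentz lebesgueHalfLine F G₂ f) ∧
    (((G₁.Dilatory ∨ G₂.Dilatory) ∧ G₁.Delta2 ∨ G₂.Delta2) →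
      (∃ c : ℝ≥0, ∀ f : ℝ≥0 → ℂ, Measurable f →
          orliczLorentz lebesgueHalfLine F G₁ f ≤ c * orliczLorentz lebesgueHalfLine F G₂ f) →
        (G₁.comp G₂.symm).AlmostConvex) ∧
    (G₂.Dilatory ∧ G₂.Delta2 →
      ((G₁.comp G₂.symm).AlmostConvex ↔ G₁.AlmostMoreConvex G₂)) ∧
    ((G₁.comp G₂.symm).AlmostConvex ↔
      ∃ H : PhiFunction, H.IsNFunction ∧ H.ConditionJ ∧
        (G₁.comp G₂.symm).EquivalentlyMoreConvex H.symm) := by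
  refine ⟨fun hdil hT => ?_, fun hΔ h => ?_, fun h => ?_, fun hT => ?_, ?_⟩
  · obtain ⟨H, -, hJ, hH⟩ := hT.exists_nFunction
    have hG₁ : G₁.Dilatory := hdil.elim id fun h₂ => hT.dilatory.of_comp_symm h₂
    obtain ⟨c, hc⟩ := PhiFunction.exists_orliczLorentz_le F (hJ.summablyControlled hH) hG₁
    exact ⟨c, fun f _ => hc f⟩
  · exact (PhiFunction.sparselyControlled_of_orliczLorentz_le F (hΔ.imp And.right id)
      h).almostConvex
  · exact PhiFunction.almostConvex_iff_almostMoreConvex h.1 h.2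
  · exact hT.exists_nFunction
  · rintro ⟨H, -, hJ, hH⟩
    exact (hJ.summablyControlled hH).almostConvex
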